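/- Notation. Let $(\mathcal M,d)$ be a uniquely geodesic metric space, and let $\gamma_p^q:[0,d(p,q)]\to\mathcal M$ be the geodesic from $p$ to $q$. For $p\ne q$, $p\neq r$ let $\bar\angle_p(q,r)=\arccos\frac{d^2(p,q)+d^2(p,r)-d^2(q,r)}{2d(p,q)d(p,r)}$ and let $\angle_p(q,r)=\lim_{\rho\to0}\sup_{0<t,s<\rho}\bar\angle_p(\gamma_p^q(t),\gamma_p^r(s))$ be the Alexandrov angle. Let $h(\beta;x,\mu)=d(\mu,x)\,d(\mu,\beta)\cos\angle_\mu(x,\beta)$ be the Alexandrov inner product (equal to $0$ if $x=\mu$ or $\beta=\mu$). Let $D_\kappa=\pi/\sqrt\kappa$ if $\kappa>0$ and $D_\kappa=\infty$ otherwise. The curvature of $\mathcal M$ is bounded above by $\kappa$ if every geodesic triangle $\triangle(p,q,r)$ of perimeter less than $2D_\kappa$ has a comparison triangle $\triangle(\bar p,\bar q,\bar r)$ with the same side lengths in the model plane $(M_\kappa^2,d_\kappa)$ of constant curvature $\kappa$ such that $d(x,y)\le d_\kappa(\bar x,\bar y)$ for all $x$ on the side $pq$ and $y$ on the side $pr$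 with comparison points $\bar x,\bar y$. Setting. Let $(X,Y)$ be a random pair in $\mathcal M\times\{0,1\}$ such that the distribution of $X$ has bounded support, $X$ has a unique Fréchet mean $\mu^*=\arg\min_{\mu}\mathbb E\,d^2(X,\mu)$, and, for some $\beta^*\in\mathcal M$, $\mathbb P(Y=1\mid X)=\{1+\exp(-h(\beta^*;X,\mu^*))\}^{-1}$ almost surely. Let $(X_i,Y_i)$, $i\ge1$, be i.i.d. copies of $(X,Y)$, independent of $(X,Y)$. For each sample size $n\geq 1$ let $\hat\mu_n$ be the sample Fréchet mean of $X_1,\dots,X_n$, assumed to exist and to be unique almost surely, and let $\hat\beta_n$ be any measurable function of the sample that almost surely maximizes $$L_n(\beta)=\frac1n\sum_{i=1}^n\bigl\{Y_ih(\beta;X_i,\hat\mu_n)-\log(1+e^{h(\beta;X_i,\hat\mu_n)})\bigr\}$$ over $\beta\in\mathcal M$ (such a maximizer being assumed to exist almost surely). Let $s^*(x)=1$ if $h(\beta^*;x,\mu^*)\ge0$ and $s^*(x)=0$ otherwise (the Bayes classifier), let $\hat s(x)=1$ if $h(\hat\beta_n;x,\hat\mu_n)\ge0$ and $\hat s(x)=0$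 otherwise (the plug-in classifier, assumed to be measurable in the sample and $x$), and let $\mathcal E(s^*,\hat s)=\mathbb P(\hat s(X)\ne Y)-\mathbb P(s^*(X)\ne Y)$ be the excess risk. The function $h(\beta^*;x,\mu)$ is called regular near $\mu^*$ if there are constants $C_1,C_2>0$ and $0<r_1\le r_2$ such that for all $\mu$ with $d(\mu,\mu^*)\le r_2$: 1) $|h(\beta^*;x,\mu)-h(\beta^*;x,\mu^*)|\le C_2\,d(\mu,\mu^*)$ for all $x$ with $d(x,\mu^*)\le r_2$, and 2) $|d(\beta^*,\mu)\cos\angle_\mu(x,\beta^*)-d(\beta^*,\mu^*)\cos\angle_{\mu^*}(x,\beta^*)|\le C_1\,d(\mu,\mu^*)$ for all $x\neq\mu$ with $d(x,\mu^*)=r_1$ (a term with factor $d(\beta^*,\mu)=0$ or $d(\beta^*,\mu^*)=0$ being $0$). Theorem. Let $\mathcal M$ be complete, with curvature bounded above by some $\kappa\in\mathbb R$ and with diameter at most $D_\kappa/2$, and let $h(\beta^*;x,\mu)$ be regular near $\mu^*$. Then, in the above setting, there is a constant $c>0$, not depending on $n$ or on the choice of the estimators, such that for all $n\ge1$ $$\mathcal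 E(s^*,\hat s)\le c\,\bigl(\mathbb E[d^2(\mu^*,\hat\mu_n)]+\mathbb E[d^2(\beta^*,\hat\beta_n)]\bigr)^{1/2},$$ where the right-hand side is $+\infty$ if one of the expectations is infinite. -/

import Mathlib

open MeasureTheory ProbabilityTheory Filter Topology
open scoped ENNReal

noncomputable section

namespace AlexandrovLogit

/-! ### Geodesics -/

/-- `γ`, restricted to `[0, dist p q]`, is a geodesic connecting `p` to `q`. The values of `γ`
outside of this interval play no role. -/
def IsGeodesic {M : Type*} [Dist M] (γ : ℝ → M) (p q : M) : Prop :=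
  γ 0 = p ∧ γ (dist p q) = q ∧
    ∀ s ∈ Set.Icc 0 (dist p q), ∀ t ∈ Set.Icc 0 (dist p q), dist (γ s) (γ t) = |s - t|

/-- Every two points are connected by exactly one geodesic. -/
def IsUniquelyGeodesic (M : Type*) [Dist M] : Prop :=
  ∀ p q : M, (∃ γ : ℝ → M, IsGeodesic γ p q) ∧
    ∀ γ η : ℝ → M, IsGeodesic γ p q → IsGeodesic η p q → Set.EqOn γ η (Set.Icc 0 (dist p q))

open Classical in
/-- The geodesic connecting `p` to `q` (the constant `p` if there is none). -/
def geod {M : Type*} [Dist M] (p q : M) : ℝ → M :=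
  if h : ∃ γ : ℝ → M, IsGeodesic γ p q then h.choose else fun _ => p

/-! ### Reference planes and upper curvature bounds -/

/-- The reference plane of curvature `κ`: the plane `z = 0` if `κ = 0`, the upper sheet of the
hyperboloid if `κ < 0`, the unit sphere if `κ > 0`. -/
structure ModelPlane (κ : ℝ) where
  x : ℝ
  y : ℝ
  z : ℝ
  flat : κ = 0 → z = 0
  hyperbolic : κ < 0 → x ^ 2 + y ^ 2 - z ^ 2 = -1 ∧ 0 < z
  spherical : 0 < κ → x ^ 2 + y ^ 2 + z ^ 2 = 1

/-- The distance of the reference plane: Euclidean, hyperbolic or angular, rescaled so that the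
curvature is `κ`. -/
instance (κ : ℝ) : Dist (ModelPlane κ) where
  dist p q :=
    if κ = 0 then √((p.x - q.x) ^ 2 + (p.y - q.y) ^ 2)
    else if κ < 0 then Real.arcosh (p.z * q.z - p.x * q.x - p.y * q.y) / √(-κ)
    else Real.arccos (p.x * q.x + p.y * q.y + p.z * q.z) / √κ

/-- `D_κ = π / √κ` if `κ > 0`, and `D_κ = ∞` otherwise. -/
def modelDiam (κ : ℝ) : ℝ≥0∞ :=
  if 0 < κ then ENNReal.ofReal (Real.pi / √κ) else ⊤

/-- The (global) curvature of `M` is bounded above by `κ`: each geodesic triangle `p, q, r` of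
perimeter less than `2 D_κ` has a comparison triangle in the reference plane such that points on
the sides `pq` and `pr` are not further apart than their comparison points. The comparison point
of `γ s` is `γ' s`, since both have distance `s` from the first vertex. -/
def CurvatureLE (M : Type*) [MetricSpace M] (κ : ℝ) : Prop :=
  ∀ (p q r : M) (γ η : ℝ → M), IsGeodesic γ p q → IsGeodesic η p r →
    ENNReal.ofReal (dist p q + dist p r + dist q r) < 2 * modelDiam κ →
    ∃ (p' q' r' : ModelPlane κ) (γ' η' : ℝ → ModelPlane κ),
      dist p' q' = dist p q ∧ dist p' r' = dist p r ∧ dist q' r' = dist q r ∧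
      IsGeodesic γ' p' q' ∧ IsGeodesic η' p' r' ∧
      ∀ s ∈ Set.Icc 0 (dist p q), ∀ t ∈ Set.Icc 0 (dist p r),
        dist (γ s) (η t) ≤ dist (γ' s) (η' t)

/-! ### Angles and the Alexandrov inner product -/

/-- The (Euclidean) comparison angle between `q` and `r` at `p`. -/
def comparisonAngle {M : Type*} [Dist M] (p q r : M) : ℝ :=
  Real.arccos ((dist p q ^ 2 + dist p r ^ 2 - dist q r ^ 2) / (2 * dist p q * dist p r))

/-- The Alexandrov angle between `γ` and `η` emanating from `p`: the upper limit, as `t` and `s`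
decrease to `0` independently, of the comparison angle between `γ t` and `η s` at `p`. -/
def alexandrovAngle {M : Type*} [Dist M] (p : M) (γ η : ℝ → M) : ℝ :=
  limsup (fun ts : ℝ × ℝ => comparisonAngle p (γ ts.1) (η ts.2)) (𝓝[>] 0 ×ˢ 𝓝[>] 0)

/-- The angle at `p` between the geodesics from `p` to `q` and from `p` to `r`; meaningful
for `q ≠ p` and `r ≠ p`. -/
def angleAt {M : Type*} [Dist M] (p q r : M) : ℝ :=
  alexandrovAngle p (geod p q) (geod p r)

/-- The Alexandrov inner product `h(β; x, μ) = d(μ, x) d(μ, β) cos ∠_μ(x, β)`, which is `0` if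
`x = μ` or `β = μ`. -/
def innerAt {M : Type*} [Dist M] (β x μ : M) : ℝ :=
  dist μ x * dist μ β * Real.cos (angleAt μ x β)

/-- `h(β; x, μ)` is regular near `m` (as a function of `μ`). -/
def IsRegularNear {M : Type*} [MetricSpace M] (β m : M) : Prop :=
  ∃ C₁ C₂ r₁ r₂ : ℝ, 0 < C₁ ∧ 0 < C₂ ∧ 0 < r₁ ∧ r₁ ≤ r₂ ∧
    ∀ μ ∈ Metric.closedBall m r₂,
      (∀ x ∈ Metric.closedBall m r₂,
        |innerAt β x μ - innerAt β x m| ≤ C₂ * dist μ m) ∧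
      ∀ x : M, dist x m = r₁ → x ≠ μ →
        |dist β μ * Real.cos (angleAt μ x β) - dist β m * Real.cos (angleAt m x β)|
          ≤ C₁ * dist μ m

/-! ### Regression model, estimators and classifiers -/

/-- `m` is the unique Fréchet mean of the random element `X`. -/
def IsFrechetMean {Ω M : Type*} [MeasurableSpace Ω] [MetricSpace M] (P : Measure Ω)
    (X : Ω → M) (m : M) : Prop :=
  ∀ m' : M, m' ≠ m → ∫ ω, dist (X ω) m ^ 2 ∂P < ∫ ω, dist (X ω) m' ^ 2 ∂P

/-- `m` is the unique sample Fréchet mean of the points `x 0, …, x (n - 1)`. -/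
def IsSampleFrechetMean {M : Type*} [MetricSpace M] {n : ℕ} (x : Fin n → M) (m : M) : Prop :=
  ∀ m' : M, m' ≠ m →
    (n : ℝ)⁻¹ * ∑ i, dist (x i) m ^ 2 < (n : ℝ)⁻¹ * ∑ i, dist (x i) m' ^ 2

/-- The empirical log-likelihood of `β`, with `μ` plugged in for the Fréchet mean. -/
def logLik {M : Type*} [MetricSpace M] {n : ℕ} (z : Fin n → M × Fin 2) (μ β : M) : ℝ :=
  (n : ℝ)⁻¹ * ∑ i, ((((z i).2 : ℕ) : ℝ) * innerAt β (z i).1 μ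
    - Real.log (1 + Real.exp (innerAt β (z i).1 μ)))

/-- The logistic model: `P(Y = 1 ∣ X) = 1 / (1 + exp (-h(β; X, μ)))` almost surely. -/
def IsLogisticModel {Ω M : Type*} [MeasurableSpace Ω] [MetricSpace M] [MeasurableSpace M]
    (P : Measure Ω) (X : Ω → M) (Y : Ω → Fin 2) (β μ : M) : Prop :=
  P⟦{ω | Y ω = 1} | MeasurableSpace.comap X inferInstance⟧
    =ᵐ[P] fun ω => (1 + Real.exp (-innerAt β (X ω) μ))⁻¹

open Classical in
/-- The classifier with parameters `β` and `μ`: class `1` if `h(β; x, μ) ≥ 0`, that is, if the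
success probability at `x` is at least `1 / 2`, and class `0` otherwise. -/
def classifier {M : Type*} [MetricSpace M] (β μ x : M) : Fin 2 :=
  if 0 ≤ innerAt β x μ then 1 else 0

/-- The excess risk `P(s(X) ≠ Y) - P(s₀(X) ≠ Y)` of a (possibly random) classifier `s` over
`s₀`. -/
def excessRisk {Ω M : Type*} [MeasurableSpace Ω] (P : Measure Ω) (X : Ω → M) (Y : Ω → Fin 2)
    (s₀ : M → Fin 2) (s : Ω → M → Fin 2) : ℝ :=
  P.real {ω | s ω (X ω) ≠ Y ω} - P.real {ω | s₀ (X ω) ≠ Y ω}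

end AlexandrovLogit

end

open AlexandrovLogit

/-! Fix the sample. By the logistic model, predicting differently from the Bayes classifier at `x`
costs `|2π(x) - 1| ≤ |h(β*; x, μ*)|`, where `π(x)` is the success probability. Where the two
classifiers disagree, the values of `h` at the true and at the estimated parameters lie on different
sides of zero, so this cost is at most their difference. The theorem thus reduces to a Lipschitz
estimate for `h` in `(β, μ)` at `(β*, μ*)`, uniform over the bounded support
(`exists_innerAt_lipschitz`). Independence of the new pair from the sample, Fubini and
Cauchy-Schwarz then give the root of the mean squared distances. If the estimate of `μ*` is far off,
the trivial bound `1` for the risk suffices.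

Lipschitz continuity in `β` is geometry of the tangent cone. Monotonicity of model-plane comparison
angles makes Alexandrov angles genuine limits, so cone distances are limits of rescaled distances
and inherit the triangle inequality (`cone_triangle`). Since the Alexandrov angle is at most the
comparison angle, passing from `M` to the cone stretches distances by at most a constant `K`
(`cone_dist_le`). Polarization turns both facts into a Lipschitz bound for `q ↦ d(p, q) cos ∠_p(x,
q)` (`abs_dist_mul_cos_sub_le`).

Lipschitz continuity in `μ` is part of regularity for `x` near `μ*`. A distant `x` is replaced by
the point where the geodesic from `μ` to `x` meets a small sphere about `μ*`: the angle at `μ` is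
unchanged, and the angle at `μ*` changes little by the comparison inequality and the cone estimate
(`exists_on_sphere`).

The three signs of the curvature are treated together through a generalized sine `sn`
(`HasComparison`). -/

noncomputable section

namespace AlexandrovLogit

/-! ### Laws of cosines in the reference planes -/

namespace ModelPlane

variable {κ : ℝ}

lemma sq_dist_flat (p q : ModelPlane 0) :
    dist p q ^ 2 = (p.x - q.x) ^ 2 + (p.y - q.y) ^ 2 := by
  have : dist p q = √((p.x - q.x) ^ 2 + (p.y - q.y) ^ 2) := by simp [dist]
  rw [this, Real.sq_sqrt (by positivity)]

lemma cos_dist (hκ : 0 < κ) (p q : ModelPlane κ) :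
    Real.cos (√κ * dist p q) = p.x * q.x + p.y * q.y + p.z * q.z := by
  have h : dist p q = Real.arccos (p.x * q.x + p.y * q.y + p.z * q.z) / √κ := by
    simp [dist, hκ.ne', hκ.not_gt]
  have hk : √κ ≠ 0 := (Real.sqrt_pos.2 hκ).ne'
  have hp := p.spherical hκ
  have hq := q.spherical hκ
  rw [h, mul_div_cancel₀ _ hk, Real.cos_arccos]
  · nlinarith [sq_nonneg (p.x + q.x), sq_nonneg (p.y + q.y), sq_nonneg (p.z + q.z)]
  · nlinarith [sq_nonneg (p.x - q.x), sq_nonneg (p.y - q.y), sq_nonneg (p.z - q.z)]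

lemma mul_dist_mem_Icc (hκ : 0 < κ) (p q : ModelPlane κ) :
    √κ * dist p q ∈ Set.Icc 0 Real.pi := by
  have h : dist p q = Real.arccos (p.x * q.x + p.y * q.y + p.z * q.z) / √κ := by
    simp [dist, hκ.ne', hκ.not_gt]
  rw [h, mul_div_cancel₀ _ (Real.sqrt_pos.2 hκ).ne']
  exact ⟨Real.arccos_nonneg _, Real.arccos_le_pi _⟩

/-- This is Cauchy-Schwarz for the vectors `(1, p.x, p.y)` and `(1, q.x, q.y)`, whose norms are
`p.z` and `q.z`. -/
lemma one_le_lorentz (hκ : κ < 0) (p q : ModelPlane κ) :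
    1 ≤ p.z * q.z - p.x * q.x - p.y * q.y := by
  obtain ⟨hp, hp0⟩ := p.hyperbolic hκ
  obtain ⟨hq, hq0⟩ := q.hyperbolic hκ
  have h : (1 + (p.x * q.x + p.y * q.y)) ^ 2 ≤ (p.z * q.z) ^ 2 := by
    have hz : (p.z * q.z) ^ 2 = (1 + p.x ^ 2 + p.y ^ 2) * (1 + q.x ^ 2 + q.y ^ 2) := by
      rw [mul_pow]; congr 1 <;> linarith
    rw [hz]
    nlinarith [sq_nonneg (p.x - q.x), sq_nonneg (p.y - q.y), sq_nonneg (p.x * q.y - p.y * q.x)]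
  have := abs_le_of_sq_le_sq' h (by positivity)
  linarith [this.2]

lemma cosh_dist (hκ : κ < 0) (p q : ModelPlane κ) :
    Real.cosh (√(-κ) * dist p q) = p.z * q.z - p.x * q.x - p.y * q.y := by
  have h : dist p q = Real.arcosh (p.z * q.z - p.x * q.x - p.y * q.y) / √(-κ) := by
    simp [dist, hκ.ne, hκ]
  rw [h, mul_div_cancel₀ _ (Real.sqrt_pos.2 (neg_pos.2 hκ)).ne',
    Real.cosh_arcosh (one_le_lorentz hκ p q)]

lemma dist_nonneg_of_neg (hκ : κ < 0) (p q : ModelPlane κ) : 0 ≤ dist p q := by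
  have h : dist p q = Real.arcosh (p.z * q.z - p.x * q.x - p.y * q.y) / √(-κ) := by
    simp [dist, hκ.ne, hκ]
  rw [h]
  exact div_nonneg (Real.arcosh_nonneg (one_le_lorentz hκ p q)) (Real.sqrt_nonneg _)

/-- The distances from a point of a geodesic to its endpoints. -/
lemma _root_.AlexandrovLogit.IsGeodesic.dist_ends {M : Type*} [Dist M] {γ : ℝ → M} {p q : M}
    (h : IsGeodesic γ p q) {s : ℝ} (hs : s ∈ Set.Icc 0 (dist p q)) :
    dist (γ s) p = s ∧ dist (γ s) q = dist p q - s := by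
  have h0 : (0 : ℝ) ∈ Set.Icc 0 (dist p q) := ⟨le_rfl, hs.1.trans hs.2⟩
  have h1 : dist p q ∈ Set.Icc 0 (dist p q) := ⟨hs.1.trans hs.2, le_rfl⟩
  have e0 := h.2.2 s hs 0 h0
  have e1 := h.2.2 s hs _ h1
  rw [h.1, sub_zero, abs_of_nonneg hs.1] at e0
  rw [h.2.1, abs_of_nonpos (by linarith [hs.2])] at e1
  exact ⟨e0, by rw [e1]; ring⟩

/-- The distances to both endpoints determine the point: the squared norm of the difference of the
two sides expands into the three known distances and vanishes. Avoiding division keeps the case `p =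
q`. -/
lemma geodesic_flat {γ : ℝ → ModelPlane 0} {p q : ModelPlane 0} (h : IsGeodesic γ p q) {s : ℝ}
    (hs : s ∈ Set.Icc 0 (dist p q)) :
    dist p q * (γ s).x = (dist p q - s) * p.x + s * q.x ∧
      dist p q * (γ s).y = (dist p q - s) * p.y + s * q.y := by
  obtain ⟨e0, e1⟩ := h.dist_ends hs
  have h0 := sq_dist_flat (γ s) p
  have h1 := sq_dist_flat (γ s) q
  have h2 := sq_dist_flat p q
  rw [e0] at h0
  rw [e1] at h1
  set a := dist p q
  have key : (a * (γ s).x - (a - s) * p.x - s * q.x) ^ 2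
      + (a * (γ s).y - (a - s) * p.y - s * q.y) ^ 2 = 0 := by
    linear_combination (-a * (a - s)) * h0 - a * s * h1 + s * (a - s) * h2
  have hx := sq_nonneg (a * (γ s).x - (a - s) * p.x - s * q.x)
  have hy := sq_nonneg (a * (γ s).y - (a - s) * p.y - s * q.y)
  have hx0 := pow_eq_zero_iff two_ne_zero |>.1 (le_antisymm (by linarith) hx)
  have hy0 := pow_eq_zero_iff two_ne_zero |>.1 (le_antisymm (by linarith) hy)
  exact ⟨by linarith, by linarith⟩

/-- The law of cosines at `p` without the angle: `(d² - (s - t)²) / (s t)` equals `2 (1 - cos θ)`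
for the small and for the large triangle. -/
lemma law_flat {γ η : ℝ → ModelPlane 0} {p q r : ModelPlane 0} (hγ : IsGeodesic γ p q)
    (hη : IsGeodesic η p r) {s t : ℝ} (hs : s ∈ Set.Icc 0 (dist p q))
    (ht : t ∈ Set.Icc 0 (dist p r)) :
    (dist (γ s) (η t) ^ 2 - (s - t) ^ 2) * (dist p q * dist p r) ^ 2 =
      (dist q r ^ 2 - (dist p q - dist p r) ^ 2) * (s * t) * (dist p q * dist p r) := by
  obtain ⟨x1, y1⟩ := geodesic_flat hγ hs
  obtain ⟨x2, y2⟩ := geodesic_flat hη ht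
  have h0 := sq_dist_flat (γ s) (η t)
  have h1 := sq_dist_flat p q
  have h2 := sq_dist_flat p r
  have h3 := sq_dist_flat q r
  set a := dist p q
  set b := dist p r
  have hx : a * b * ((γ s).x - (η t).x) = b * s * (q.x - p.x) - a * t * (r.x - p.x) := by
    linear_combination b * x1 - a * x2
  have hy : a * b * ((γ s).y - (η t).y) = b * s * (q.y - p.y) - a * t * (r.y - p.y) := by
    linear_combination b * y1 - a * y2
  have hd : dist (γ s) (η t) ^ 2 * (a * b) ^ 2 = (b * s * (q.x - p.x) - a * t * (r.x - p.x)) ^ 2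
      + (b * s * (q.y - p.y) - a * t * (r.y - p.y)) ^ 2 := by
    rw [← hx, ← hy, h0]; ring
  linear_combination hd + (- b ^ 2 * s ^ 2 + a * b * s * t) * h1
    + (- a ^ 2 * t ^ 2 + a * b * s * t) * h2 - a * b * s * t * h3

lemma geodesic_spherical (hκ : 0 < κ) {γ : ℝ → ModelPlane κ} {p q : ModelPlane κ}
    (h : IsGeodesic γ p q) {s : ℝ} (hs : s ∈ Set.Icc 0 (dist p q)) :
    (Real.sin (√κ * dist p q) * (γ s).x =
      Real.sin (√κ * (dist p q - s)) * p.x + Real.sin (√κ * s) * q.x) ∧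
    (Real.sin (√κ * dist p q) * (γ s).y =
      Real.sin (√κ * (dist p q - s)) * p.y + Real.sin (√κ * s) * q.y) ∧
    (Real.sin (√κ * dist p q) * (γ s).z =
      Real.sin (√κ * (dist p q - s)) * p.z + Real.sin (√κ * s) * q.z) := by
  obtain ⟨e0, e1⟩ := h.dist_ends hs
  have h0 := cos_dist hκ (γ s) p
  have h1 := cos_dist hκ (γ s) q
  have h2 := cos_dist hκ p q
  have n0 := (γ s).spherical hκ
  have n1 := p.spherical hκ
  have n2 := q.spherical hκ
  rw [e0] at h0
  rw [e1] at h1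
  set a := dist p q
  rw [mul_sub, Real.cos_sub] at h1
  rw [mul_sub, Real.sin_sub]
  have t1 := Real.sin_sq_add_cos_sq (√κ * s)
  have t2 := Real.sin_sq_add_cos_sq (√κ * a)
  set S := Real.sin (√κ * s)
  set C := Real.cos (√κ * s)
  set A := Real.sin (√κ * a)
  set B := Real.cos (√κ * a)
  have key : (A * (γ s).x - ((A * C - B * S) * p.x + S * q.x)) ^ 2
      + (A * (γ s).y - ((A * C - B * S) * p.y + S * q.y)) ^ 2
      + (A * (γ s).z - ((A * C - B * S) * p.z + S * q.z)) ^ 2 = 0 := by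
    have e : (A * (γ s).x - ((A * C - B * S) * p.x + S * q.x)) ^ 2
      + (A * (γ s).y - ((A * C - B * S) * p.y + S * q.y)) ^ 2
      + (A * (γ s).z - ((A * C - B * S) * p.z + S * q.z)) ^ 2 =
      A ^ 2 * ((γ s).x ^ 2 + (γ s).y ^ 2 + (γ s).z ^ 2)
      + (A * C - B * S) ^ 2 * (p.x ^ 2 + p.y ^ 2 + p.z ^ 2)
      + S ^ 2 * (q.x ^ 2 + q.y ^ 2 + q.z ^ 2)
      - 2 * A * (A * C - B * S) * ((γ s).x * p.x + (γ s).y * p.y + (γ s).z * p.z)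
      - 2 * A * S * ((γ s).x * q.x + (γ s).y * q.y + (γ s).z * q.z)
      + 2 * (A * C - B * S) * S * (p.x * q.x + p.y * q.y + p.z * q.z) := by ring
    rw [e, n0, n1, n2, ← h0, ← h1, ← h2]
    linear_combination (-A ^ 2) * t1 - S ^ 2 * t2
  have hx := sq_nonneg (A * (γ s).x - ((A * C - B * S) * p.x + S * q.x))
  have hy := sq_nonneg (A * (γ s).y - ((A * C - B * S) * p.y + S * q.y))
  have hz := sq_nonneg (A * (γ s).z - ((A * C - B * S) * p.z + S * q.z))
  exact ⟨sub_eq_zero.1 (pow_eq_zero_iff two_ne_zero |>.1 (by linarith)),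
    sub_eq_zero.1 (pow_eq_zero_iff two_ne_zero |>.1 (by linarith)),
    sub_eq_zero.1 (pow_eq_zero_iff two_ne_zero |>.1 (by linarith))⟩

/-- Here the quantity common to both triangles is `1 - cos θ`, the quotient of the difference of
cosines by the product of the sines of the two sides at `p`. -/
lemma law_spherical (hκ : 0 < κ) {γ η : ℝ → ModelPlane κ} {p q r : ModelPlane κ}
    (hγ : IsGeodesic γ p q) (hη : IsGeodesic η p r) {s t : ℝ} (hs : s ∈ Set.Icc 0 (dist p q))
    (ht : t ∈ Set.Icc 0 (dist p r)) :
    (Real.cos (√κ * (s - t)) - Real.cos (√κ * dist (γ s) (η t))) *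
        (Real.sin (√κ * dist p q) * Real.sin (√κ * dist p r)) =
      (Real.cos (√κ * (dist p q - dist p r)) - Real.cos (√κ * dist q r)) *
        (Real.sin (√κ * s) * Real.sin (√κ * t)) := by
  obtain ⟨x1, y1, z1⟩ := geodesic_spherical hκ hγ hs
  obtain ⟨x2, y2, z2⟩ := geodesic_spherical hκ hη ht
  have h0 := cos_dist hκ (γ s) (η t)
  have h1 := cos_dist hκ p q
  have h2 := cos_dist hκ p r
  have h3 := cos_dist hκ q r
  have n1 := p.spherical hκ
  set a := dist p q
  set b := dist p r
  rw [mul_sub, Real.sin_sub] at x1 y1 z1 x2 y2 z2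
  rw [mul_sub, Real.cos_sub, mul_sub, Real.cos_sub]
  set A := Real.sin (√κ * a)
  set A' := Real.cos (√κ * a)
  set B := Real.sin (√κ * b)
  set B' := Real.cos (√κ * b)
  set S := Real.sin (√κ * s)
  set S' := Real.cos (√κ * s)
  set T := Real.sin (√κ * t)
  set T' := Real.cos (√κ * t)
  have hd : Real.cos (√κ * dist (γ s) (η t)) * (A * B) =
      (A * S' - A' * S) * (B * T' - B' * T) + (A * S' - A' * S) * T * B'
      + S * (B * T' - B' * T) * A' + S * T * Real.cos (√κ * dist q r) := by
    rw [h0, h3]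
    have : ((γ s).x * (η t).x + (γ s).y * (η t).y + (γ s).z * (η t).z) * (A * B) =
      (A * (γ s).x) * (B * (η t).x) + (A * (γ s).y) * (B * (η t).y)
        + (A * (γ s).z) * (B * (η t).z) := by ring
    rw [this, x1, y1, z1, x2, y2, z2]
    linear_combination (A * S' - A' * S) * (B * T' - B' * T) * n1
      - (A * S' - A' * S) * T * h2 - S * (B * T' - B' * T) * h1
  linear_combination -hd

/-- A lightlike vector that is orthogonal to a timelike vector vanishes. -/
lemma eq_zero_of_lorentz {px py pz wx wy wz : ℝ} (hp : px ^ 2 + py ^ 2 - pz ^ 2 = -1)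
    (hw : wz ^ 2 - wx ^ 2 - wy ^ 2 = 0) (h : wz * pz = wx * px + wy * py) :
    wx = 0 ∧ wy = 0 ∧ wz = 0 := by
  have e : wz ^ 2 = -(wx * py - wy * px) ^ 2 := by
    linear_combination (wz * pz + wx * px + wy * py) * h + wz ^ 2 * hp - (px ^ 2 + py ^ 2) * hw
  have h1 := sq_nonneg (wx * py - wy * px)
  have hx := sq_nonneg wx
  have hy := sq_nonneg wy
  have hz := sq_nonneg wz
  exact ⟨pow_eq_zero_iff two_ne_zero |>.1 (by linarith),
    pow_eq_zero_iff two_ne_zero |>.1 (by linarith),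
    pow_eq_zero_iff two_ne_zero |>.1 (by linarith)⟩

/-- The Lorentz form is indefinite, so a vanishing norm of the difference `w` is not enough.
Orthogonality of `w` to the timelike vector `p` is checked as well. -/
lemma geodesic_hyperbolic (hκ : κ < 0) {γ : ℝ → ModelPlane κ} {p q : ModelPlane κ}
    (h : IsGeodesic γ p q) {s : ℝ} (hs : s ∈ Set.Icc 0 (dist p q)) :
    (Real.sinh (√(-κ) * dist p q) * (γ s).x =
      Real.sinh (√(-κ) * (dist p q - s)) * p.x + Real.sinh (√(-κ) * s) * q.x) ∧
    (Real.sinh (√(-κ) * dist p q) * (γ s).y =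
      Real.sinh (√(-κ) * (dist p q - s)) * p.y + Real.sinh (√(-κ) * s) * q.y) ∧
    (Real.sinh (√(-κ) * dist p q) * (γ s).z =
      Real.sinh (√(-κ) * (dist p q - s)) * p.z + Real.sinh (√(-κ) * s) * q.z) := by
  obtain ⟨e0, e1⟩ := h.dist_ends hs
  have h0 := cosh_dist hκ (γ s) p
  have h1 := cosh_dist hκ (γ s) q
  have h2 := cosh_dist hκ p q
  have n0 := ((γ s).hyperbolic hκ).1
  obtain ⟨n1, hp0⟩ := p.hyperbolic hκ
  have n2 := (q.hyperbolic hκ).1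
  rw [e0] at h0
  rw [e1] at h1
  set a := dist p q
  rw [mul_sub, Real.cosh_sub] at h1
  rw [mul_sub, Real.sinh_sub]
  have t1 := Real.cosh_sq_sub_sinh_sq (√(-κ) * s)
  have t2 := Real.cosh_sq_sub_sinh_sq (√(-κ) * a)
  set S := Real.sinh (√(-κ) * s)
  set C := Real.cosh (√(-κ) * s)
  set A := Real.sinh (√(-κ) * a)
  set B := Real.cosh (√(-κ) * a)
  set wx := A * (γ s).x - ((A * C - B * S) * p.x + S * q.x) with hwx
  set wy := A * (γ s).y - ((A * C - B * S) * p.y + S * q.y) with hwy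
  set wz := A * (γ s).z - ((A * C - B * S) * p.z + S * q.z) with hwz
  have key : wz ^ 2 - wx ^ 2 - wy ^ 2 = 0 := by
    have e : wz ^ 2 - wx ^ 2 - wy ^ 2 =
      A ^ 2 * -((γ s).x ^ 2 + (γ s).y ^ 2 - (γ s).z ^ 2)
      + (A * C - B * S) ^ 2 * -(p.x ^ 2 + p.y ^ 2 - p.z ^ 2)
      + S ^ 2 * -(q.x ^ 2 + q.y ^ 2 - q.z ^ 2)
      - 2 * A * (A * C - B * S) * ((γ s).z * p.z - (γ s).x * p.x - (γ s).y * p.y)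
      - 2 * A * S * ((γ s).z * q.z - (γ s).x * q.x - (γ s).y * q.y)
      + 2 * (A * C - B * S) * S * (p.z * q.z - p.x * q.x - p.y * q.y) := by
        rw [hwx, hwy, hwz]; ring
    rw [e, n0, n1, n2, ← h0, ← h1, ← h2]
    linear_combination (-A ^ 2) * t1 - S ^ 2 * t2
  have orth : wz * p.z = wx * p.x + wy * p.y := by
    have e : wz * p.z - (wx * p.x + wy * p.y) =
      A * ((γ s).z * p.z - (γ s).x * p.x - (γ s).y * p.y)
        - (A * C - B * S) * -(p.x ^ 2 + p.y ^ 2 - p.z ^ 2)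
        - S * (p.z * q.z - p.x * q.x - p.y * q.y) := by rw [hwx, hwy, hwz]; ring
    rw [n1, ← h0, ← h2] at e
    linear_combination e
  obtain ⟨hx, hy, hz⟩ := eq_zero_of_lorentz n1 key orth
  exact ⟨sub_eq_zero.1 hx, sub_eq_zero.1 hy, sub_eq_zero.1 hz⟩

lemma law_hyperbolic (hκ : κ < 0) {γ η : ℝ → ModelPlane κ} {p q r : ModelPlane κ}
    (hγ : IsGeodesic γ p q) (hη : IsGeodesic η p r) {s t : ℝ} (hs : s ∈ Set.Icc 0 (dist p q))
    (ht : t ∈ Set.Icc 0 (dist p r)) :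
    (Real.cosh (√(-κ) * dist (γ s) (η t)) - Real.cosh (√(-κ) * (s - t))) *
        (Real.sinh (√(-κ) * dist p q) * Real.sinh (√(-κ) * dist p r)) =
      (Real.cosh (√(-κ) * dist q r) - Real.cosh (√(-κ) * (dist p q - dist p r))) *
        (Real.sinh (√(-κ) * s) * Real.sinh (√(-κ) * t)) := by
  obtain ⟨x1, y1, z1⟩ := geodesic_hyperbolic hκ hγ hs
  obtain ⟨x2, y2, z2⟩ := geodesic_hyperbolic hκ hη ht
  have h0 := cosh_dist hκ (γ s) (η t)
  have h1 := cosh_dist hκ p q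
  have h2 := cosh_dist hκ p r
  have h3 := cosh_dist hκ q r
  have n1 := (p.hyperbolic hκ).1
  set a := dist p q
  set b := dist p r
  rw [mul_sub, Real.sinh_sub] at x1 y1 z1 x2 y2 z2
  rw [mul_sub, Real.cosh_sub, mul_sub, Real.cosh_sub]
  set A := Real.sinh (√(-κ) * a)
  set A' := Real.cosh (√(-κ) * a)
  set B := Real.sinh (√(-κ) * b)
  set B' := Real.cosh (√(-κ) * b)
  set S := Real.sinh (√(-κ) * s)
  set S' := Real.cosh (√(-κ) * s)
  set T := Real.sinh (√(-κ) * t)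
  set T' := Real.cosh (√(-κ) * t)
  have hd : Real.cosh (√(-κ) * dist (γ s) (η t)) * (A * B) =
      (A * S' - A' * S) * (B * T' - B' * T) + (A * S' - A' * S) * T * B'
      + S * (B * T' - B' * T) * A' + S * T * Real.cosh (√(-κ) * dist q r) := by
    rw [h0, h3]
    have : ((γ s).z * (η t).z - (γ s).x * (η t).x - (γ s).y * (η t).y) * (A * B) =
      (A * (γ s).z) * (B * (η t).z) - (A * (γ s).x) * (B * (η t).x)
        - (A * (γ s).y) * (B * (η t).y) := by ring
    rw [this, x1, y1, z1, x2, y2, z2]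
    linear_combination -(A * S' - A' * S) * (B * T' - B' * T) * n1
      - (A * S' - A' * S) * T * h2 - S * (B * T' - B' * T) * h1
  linear_combination hd

end ModelPlane

/-! ### Comparison through a generalized sine -/

/-- `M` satisfies the hinge comparison of a reference plane whose generalized sine is `sn`:
`sn ((d + s - t) / 2) * sn ((d - s + t) / 2) / (sn s * sn t)`, the squared sine of half the
comparison angle, does not decrease when the two points move away from the vertex. -/
structure HasComparison (M : Type*) [MetricSpace M] (sn : ℝ → ℝ) (k K : ℝ) : Prop where
  k_pos : 0 < k
  one_le : 1 ≤ K
  deriv_zero : HasDerivAt sn k 0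
  map_zero : sn 0 = 0
  mono : ∀ (p q : M) (u v : ℝ), 0 ≤ u → u < v → v ≤ dist p q → sn u < sn v
  ratio : ∀ (p q : M) (u : ℝ), 0 ≤ u → u ≤ dist p q → sn u * dist p q ≤ K * u * sn (dist p q)
  comparison : ∀ (p q r : M) (γ η : ℝ → M), IsGeodesic γ p q → IsGeodesic η p r → p ≠ q → p ≠ r →
    ∀ s ∈ Set.Icc 0 (dist p q), ∀ t ∈ Set.Icc 0 (dist p r),
      sn ((dist (γ s) (η t) + s - t) / 2) * sn ((dist (γ s) (η t) - s + t) / 2) *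
          (sn (dist p q) * sn (dist p r)) ≤
        sn ((dist q r + dist p q - dist p r) / 2) * sn ((dist q r - dist p q + dist p r) / 2) *
          (sn s * sn t)

/-- Converts the difference of cosines in `law_spherical` into the half-angle form required by
`HasComparison`. -/
lemma sin_mul_sin_half (k d s t : ℝ) :
    Real.sin (k * ((d + s - t) / 2)) * Real.sin (k * ((d - s + t) / 2)) =
      (Real.cos (k * (s - t)) - Real.cos (k * d)) / 2 := by
  rw [show k * (s - t) = k * ((d + s - t) / 2) - k * ((d - s + t) / 2) by ring,
    show k * d = k * ((d + s - t) / 2) + k * ((d - s + t) / 2) by ring,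
    Real.cos_sub, Real.cos_add]
  ring

lemma sinh_mul_sinh_half (k d s t : ℝ) :
    Real.sinh (k * ((d + s - t) / 2)) * Real.sinh (k * ((d - s + t) / 2)) =
      (Real.cosh (k * d) - Real.cosh (k * (s - t))) / 2 := by
  rw [show k * (s - t) = k * ((d + s - t) / 2) - k * ((d - s + t) / 2) by ring,
    show k * d = k * ((d + s - t) / 2) + k * ((d - s + t) / 2) by ring,
    Real.cosh_sub, Real.cosh_add]
  ring

lemma sinh_mul_le {u a : ℝ} (hu : 0 ≤ u) (hua : u ≤ a) :
    Real.sinh u * a ≤ u * Real.sinh a := by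
  rcases hu.eq_or_lt with rfl | hu0
  · simp
  have ha : 0 < a := hu0.trans_le hua
  have hc : ConvexOn ℝ (Set.Ici (0 : ℝ)) Real.sinh := by
    refine MonotoneOn.convexOn_of_deriv (convex_Ici 0) Real.continuous_sinh.continuousOn
      Real.differentiable_sinh.differentiableOn ?_
    rw [interior_Ici, Real.deriv_sinh]
    intro x hx y hy hxy
    exact Real.cosh_le_cosh.2 (by rwa [abs_of_pos hx, abs_of_pos hy])
  have h := hc.2 (Set.mem_Ici.2 le_rfl) (Set.mem_Ici.2 ha.le)
    (show 0 ≤ 1 - u / a by rw [sub_nonneg, div_le_one ha]; exact hua)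
    (show 0 ≤ u / a by positivity) (by ring)
  simp only [smul_eq_mul, mul_zero, zero_add, Real.sinh_zero, div_mul_cancel₀ _ ha.ne'] at h
  calc Real.sinh u * a ≤ u / a * Real.sinh a * a := by gcongr
    _ = u * Real.sinh a := by field_simp

lemma hasComparison_flat {M : Type*} [MetricSpace M] (h : CurvatureLE M 0) :
    HasComparison M (fun u => u) 1 1 where
  k_pos := one_pos
  one_le := le_rfl
  deriv_zero := hasDerivAt_id _
  map_zero := rfl
  mono _ _ _ _ _ h _ := h
  ratio _ _ u _ _ := by simp
  comparison p q r γ η hγ hη hpq hpr s hs t ht := by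
    obtain ⟨p', q', r', γ', η', e1, e2, e3, g1, g2, H⟩ := h p q r γ η hγ hη (by
      simp [modelDiam, ENNReal.mul_top])
    have hd := H s hs t ht
    rw [← e1] at hs
    rw [← e2] at ht
    have L := ModelPlane.law_flat g1 g2 hs ht
    rw [e1, e2, e3] at L
    have ha := dist_pos.2 hpq
    have hb := dist_pos.2 hpr
    have hsq : dist (γ s) (η t) ^ 2 ≤ dist (γ' s) (η' t) ^ 2 := by gcongr
    have L' : (dist (γ' s) (η' t) ^ 2 - (s - t) ^ 2) * (dist p q * dist p r) =
        (dist q r ^ 2 - (dist p q - dist p r) ^ 2) * (s * t) := by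
      refine mul_right_cancel₀ (mul_pos ha hb).ne' ?_
      rw [← L]; ring
    have := mul_le_mul_of_nonneg_right hsq (mul_pos ha hb).le
    linarith

lemma hasComparison_hyperbolic {M : Type*} [MetricSpace M] {κ : ℝ} (hκ : κ < 0)
    (h : CurvatureLE M κ) : HasComparison M (fun u => Real.sinh (√(-κ) * u)) √(-κ) 1 where
  k_pos := Real.sqrt_pos.2 (neg_pos.2 hκ)
  one_le := le_rfl
  deriv_zero := by
    have := ((hasDerivAt_id (0 : ℝ)).const_mul √(-κ)).sinh
    simpa using this
  map_zero := by simp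
  mono _ _ u v _ h _ := Real.sinh_lt_sinh.2
    (mul_lt_mul_of_pos_left h (Real.sqrt_pos.2 (neg_pos.2 hκ)))
  ratio p q u hu hv := by
    have hk := Real.sqrt_pos.2 (neg_pos.2 hκ)
    have := sinh_mul_le (mul_nonneg hk.le hu) (mul_le_mul_of_nonneg_left hv hk.le)
    refine le_of_mul_le_mul_left ?_ hk
    linarith
  comparison p q r γ η hγ hη hpq hpr s hs t ht := by
    have hk := Real.sqrt_pos.2 (neg_pos.2 hκ)
    obtain ⟨p', q', r', γ', η', e1, e2, e3, g1, g2, H⟩ := h p q r γ η hγ hη (by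
      simp [modelDiam, ENNReal.mul_top, hκ.not_gt])
    have hd := H s hs t ht
    rw [← e1] at hs
    rw [← e2] at ht
    have L := ModelPlane.law_hyperbolic hκ g1 g2 hs ht
    rw [e1, e2, e3] at L
    have ha := Real.sinh_pos_iff.2 (mul_pos hk (dist_pos.2 hpq))
    have hb := Real.sinh_pos_iff.2 (mul_pos hk (dist_pos.2 hpr))
    have hc : Real.cosh (√(-κ) * dist (γ s) (η t)) ≤ Real.cosh (√(-κ) * dist (γ' s) (η' t)) := by
      refine Real.cosh_le_cosh.2 ?_
      rw [abs_of_nonneg (by positivity), abs_of_nonneg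
        (mul_nonneg hk.le (ModelPlane.dist_nonneg_of_neg hκ _ _))]
      gcongr
    simp only [sinh_mul_sinh_half]
    have := mul_le_mul_of_nonneg_right hc (mul_pos ha hb).le
    linarith

/-- The diameter bound keeps `√κ` times any distance within `[0, π / 2]`. There the sine increases,
Jordan's inequality gives the constant `π / 2`, and every perimeter stays below `2 D_κ`. -/
lemma hasComparison_spherical {M : Type*} [MetricSpace M] {κ : ℝ} (hκ : 0 < κ)
    (h : CurvatureLE M κ) (hdiam : Metric.ediam (Set.univ : Set M) ≤ modelDiam κ / 2) :
    HasComparison M (fun u => Real.sin (√κ * u)) √κ (Real.pi / 2) := by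
  have hk := Real.sqrt_pos.2 hκ
  have hdist : ∀ p q : M, √κ * dist p q ≤ Real.pi / 2 := by
    intro p q
    have h1 : edist p q ≤ ENNReal.ofReal (Real.pi / √κ) / 2 := by
      have := (Metric.edist_le_ediam_of_mem (Set.mem_univ p) (Set.mem_univ q)).trans hdiam
      rwa [modelDiam, if_pos hκ] at this
    rw [← ENNReal.ofReal_ofNat 2, ← ENNReal.ofReal_div_of_pos two_pos,
      edist_le_ofReal (by positivity)] at h1
    calc √κ * dist p q ≤ √κ * (Real.pi / √κ / 2) := by gcongr
      _ = Real.pi / 2 := by field_simp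
  refine ⟨hk, by linarith [Real.pi_gt_three], ?_, by simp, ?_, ?_, ?_⟩
  · have := ((hasDerivAt_id (0 : ℝ)).const_mul √κ).sin
    simpa using this
  · intro p q u v hu huv hv
    have hv' := (mul_le_mul_of_nonneg_left hv hk.le).trans (hdist p q)
    exact Real.sin_lt_sin_of_lt_of_le_pi_div_two
      (by linarith [mul_nonneg hk.le hu, Real.pi_pos]) hv' (mul_lt_mul_of_pos_left huv hk)
  · intro p q u hu hv
    have h1 : Real.sin (√κ * u) ≤ √κ * u := Real.sin_le (by positivity)
    have h2 := Real.mul_le_sin (mul_nonneg hk.le dist_nonneg) (hdist p q)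
    have h3 : √κ * dist p q ≤ Real.pi / 2 * Real.sin (√κ * dist p q) := by
      calc √κ * dist p q = Real.pi / 2 * (2 / Real.pi * (√κ * dist p q)) := by
            field_simp
        _ ≤ _ := by gcongr
    calc Real.sin (√κ * u) * dist p q ≤ √κ * u * dist p q := by gcongr
      _ = u * (√κ * dist p q) := by ring
      _ ≤ u * (Real.pi / 2 * Real.sin (√κ * dist p q)) := by gcongr
      _ = _ := by ring
  · intro p q r γ η hγ hη hpq hpr s hs t ht
    have hper : ENNReal.ofReal (dist p q + dist p r + dist q r) < 2 * modelDiam κ := by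
      rw [modelDiam, if_pos hκ, ← ENNReal.ofReal_ofNat 2, ← ENNReal.ofReal_mul two_pos.le,
        ENNReal.ofReal_lt_ofReal_iff (by positivity)]
      refine lt_of_mul_lt_mul_left ?_ hk.le
      have : √κ * (2 * (Real.pi / √κ)) = 2 * Real.pi := by field_simp
      rw [this]
      linarith [hdist p q, hdist p r, hdist q r, Real.pi_pos]
    obtain ⟨p', q', r', γ', η', e1, e2, e3, g1, g2, H⟩ := h p q r γ η hγ hη hper
    have hd := H s hs t ht
    rw [← e1] at hs
    rw [← e2] at ht
    have L := ModelPlane.law_spherical hκ g1 g2 hs ht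
    rw [e1, e2, e3] at L
    have hpos : ∀ p q : M, p ≠ q → 0 < Real.sin (√κ * dist p q) := fun p q hpq =>
      Real.sin_pos_of_pos_of_lt_pi (mul_pos hk (dist_pos.2 hpq))
        (by linarith [hdist p q, Real.pi_pos])
    have hc : Real.cos (√κ * dist (γ' s) (η' t)) ≤ Real.cos (√κ * dist (γ s) (η t)) :=
      Real.cos_le_cos_of_nonneg_of_le_pi (by positivity)
        (ModelPlane.mul_dist_mem_Icc hκ _ _).2 (by gcongr)
    simp only [sin_mul_sin_half]
    have := mul_le_mul_of_nonneg_right hc (mul_pos (hpos p q hpq) (hpos p r hpr)).le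
    linarith

lemma exists_hasComparison {M : Type*} [MetricSpace M] {κ : ℝ}
    (h : CurvatureLE M κ) (hdiam : Metric.ediam (Set.univ : Set M) ≤ modelDiam κ / 2) :
    ∃ sn k K, HasComparison M sn k K := by
  rcases lt_trichotomy κ 0 with hκ | rfl | hκ
  · exact ⟨_, _, _, hasComparison_hyperbolic hκ h⟩
  · exact ⟨_, _, _, hasComparison_flat h⟩
  · exact ⟨_, _, _, hasComparison_spherical hκ h hdiam⟩

/-! ### Existence of angles -/

section Angles

variable {M : Type*} [MetricSpace M]

lemma IsGeodesic.dist_left {γ : ℝ → M} {p q : M} (h : IsGeodesic γ p q) {s : ℝ}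
    (hs : s ∈ Set.Icc 0 (dist p q)) : dist p (γ s) = s := by
  rw [dist_comm]; exact (h.dist_ends hs).1

lemma IsGeodesic.restrict {γ : ℝ → M} {p q : M} (h : IsGeodesic γ p q) {s : ℝ}
    (hs : s ∈ Set.Icc 0 (dist p q)) : IsGeodesic γ p (γ s) := by
  have hd := h.dist_left hs
  refine ⟨h.1, by rw [hd], fun u hu v hv => h.2.2 u ?_ v ?_⟩ <;> rw [hd] at *
  · exact ⟨hu.1, hu.2.trans hs.2⟩
  · exact ⟨hv.1, hv.2.trans hs.2⟩

lemma IsGeodesic.reverse {γ : ℝ → M} {p q : M} (h : IsGeodesic γ p q) :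
    IsGeodesic (fun s => γ (dist p q - s)) q p := by
  refine ⟨by simpa using h.2.1, by simpa [dist_comm q p] using h.1, fun s hs t ht => ?_⟩
  rw [dist_comm q p] at hs ht
  rw [h.2.2 _ ⟨by linarith [hs.2], by linarith [hs.1]⟩ _ ⟨by linarith [ht.2], by linarith [ht.1]⟩,
    abs_sub_comm]
  congr 1; ring

lemma IsUniquelyGeodesic.isGeodesic_geod (h : IsUniquelyGeodesic M) (p q : M) :
    IsGeodesic (geod p q) p q := by
  rw [geod, dif_pos (h p q).1]
  exact (h p q).1.choose_spec

/-- The cosine of the Euclidean comparison angle at `p` of points at distances `ts.1` and `ts.2`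
from `p` on two curves. -/
def cosComparison (γ η : ℝ → M) (ts : ℝ × ℝ) : ℝ :=
  (ts.1 ^ 2 + ts.2 ^ 2 - dist (γ ts.1) (η ts.2) ^ 2) / (2 * ts.1 * ts.2)

namespace HasComparison

variable {sn : ℝ → ℝ} {k K : ℝ}

lemma pos (H : HasComparison M sn k K) {p q : M} {u : ℝ} (hu : 0 < u) (hv : u ≤ dist p q) :
    0 < sn u := by
  have := H.mono p q 0 u le_rfl hu hv
  rwa [H.map_zero] at this

lemma nonneg (H : HasComparison M sn k K) {p q : M} {u : ℝ} (hu : 0 ≤ u) (hv : u ≤ dist p q) :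
    0 ≤ sn u := by
  rcases hu.eq_or_lt with rfl | hu
  · exact H.map_zero.ge
  · exact (H.pos hu hv).le

lemma dslope_mul (H : HasComparison M sn k K) (u : ℝ) : sn u = dslope sn 0 u * u := by
  have := sub_smul_dslope sn 0 u
  rw [H.map_zero, sub_zero, sub_zero, smul_eq_mul] at this
  rw [← this, mul_comm]

lemma tendsto_dslope (H : HasComparison M sn k K) : Tendsto (dslope sn 0) (𝓝 0) (𝓝 k) := by
  have h := (continuousAt_dslope_same.2 H.deriv_zero.differentiableAt).tendsto
  rwa [dslope_same, H.deriv_zero.deriv] at h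

/-- The squared sine of half the angle between two geodesics in the reference plane. -/
def sinSqHalf (sn : ℝ → ℝ) (γ η : ℝ → M) (ts : ℝ × ℝ) : ℝ :=
  sn ((dist (γ ts.1) (η ts.2) + ts.1 - ts.2) / 2) * sn ((dist (γ ts.1) (η ts.2) - ts.1 + ts.2) / 2)
    / (sn ts.1 * sn ts.2)

variable {γ η : ℝ → M} {p q r : M}

/-- The comparison inequality applies to the hinge whose endpoints are `γ s'` and `η t'`. -/
lemma sinSqHalf_mono (H : HasComparison M sn k K) (hγ : IsGeodesic γ p q) (hη : IsGeodesic η p r)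
    {s t s' t' : ℝ} (hs : 0 < s) (ht : 0 < t) (hss : s ≤ s') (htt : t ≤ t')
    (hs' : s' ≤ dist p q) (ht' : t' ≤ dist p r) :
    sinSqHalf sn γ η (s, t) ≤ sinSqHalf sn γ η (s', t') := by
  have ms : s' ∈ Set.Icc 0 (dist p q) := ⟨hs.le.trans hss, hs'⟩
  have mt : t' ∈ Set.Icc 0 (dist p r) := ⟨ht.le.trans htt, ht'⟩
  have ds := hγ.dist_left ms
  have dt := hη.dist_left mt
  have h := H.comparison p (γ s') (η t') γ η (hγ.restrict ms) (hη.restrict mt)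
    (dist_pos.1 (by rw [ds]; linarith)) (dist_pos.1 (by rw [dt]; linarith))
    s ⟨hs.le, by rwa [ds]⟩ t ⟨ht.le, by rwa [dt]⟩
  rw [ds, dt] at h
  have p1 := H.pos hs (hss.trans hs')
  have p2 := H.pos ht (htt.trans ht')
  have p3 := H.pos (hs.trans_le hss) hs'
  have p4 := H.pos (ht.trans_le htt) ht'
  simp only [sinSqHalf]
  rw [div_le_div_iff₀ (mul_pos p1 p2) (mul_pos p3 p4)]
  exact h

lemma dist_bounds (hγ : IsGeodesic γ p q) (hη : IsGeodesic η p r) {s t : ℝ}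
    (hs : s ∈ Set.Icc 0 (dist p q)) (ht : t ∈ Set.Icc 0 (dist p r)) :
    0 ≤ (dist (γ s) (η t) + s - t) / 2 ∧ (dist (γ s) (η t) + s - t) / 2 ≤ s ∧
    0 ≤ (dist (γ s) (η t) - s + t) / 2 ∧ (dist (γ s) (η t) - s + t) / 2 ≤ t := by
  have ds := hγ.dist_left hs
  have dt := hη.dist_left ht
  have h1 := dist_triangle p (γ s) (η t)
  have h2 := dist_triangle_right p (γ s) (η t)
  have h3 := dist_triangle_left (γ s) (η t) p
  rw [ds, dt] at h1 h2 h3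
  exact ⟨by linarith, by linarith, by linarith, by linarith⟩

lemma sinSqHalf_nonneg (H : HasComparison M sn k K) (hγ : IsGeodesic γ p q)
    (hη : IsGeodesic η p r) {s t : ℝ} (hs : s ∈ Set.Icc 0 (dist p q))
    (ht : t ∈ Set.Icc 0 (dist p r)) : 0 ≤ sinSqHalf sn γ η (s, t) := by
  obtain ⟨h1, h2, h3, h4⟩ := dist_bounds hγ hη hs ht
  exact div_nonneg (mul_nonneg (H.nonneg h1 (h2.trans hs.2)) (H.nonneg h3 (h4.trans ht.2)))
    (mul_nonneg (H.nonneg hs.1 hs.2) (H.nonneg ht.1 ht.2))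

lemma mem_prod_nhdsGT {a b : ℝ} (ha : 0 < a) (hb : 0 < b) :
    ∀ᶠ ts : ℝ × ℝ in 𝓝[>] 0 ×ˢ 𝓝[>] 0, ts.1 ∈ Set.Ioc 0 a ∧ ts.2 ∈ Set.Ioc 0 b :=
  prod_mem_prod (Ioc_mem_nhdsGT ha) (Ioc_mem_nhdsGT hb)

/-- By monotonicity in both variables and nonnegativity, the limit is the infimum. -/
lemma exists_tendsto_sinSqHalf (H : HasComparison M sn k K) (hγ : IsGeodesic γ p q)
    (hη : IsGeodesic η p r) (hq : p ≠ q) (hr : p ≠ r) :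
    ∃ l, l ≤ sinSqHalf sn γ η (dist p q, dist p r) ∧
      Tendsto (sinSqHalf sn γ η) (𝓝[>] 0 ×ˢ 𝓝[>] 0) (𝓝 l) := by
  have ha := dist_pos.2 hq
  have hb := dist_pos.2 hr
  set S := sinSqHalf sn γ η '' (Set.Ioc 0 (dist p q) ×ˢ Set.Ioc 0 (dist p r))
  have hS : BddBelow S := by
    refine ⟨0, ?_⟩
    rintro _ ⟨⟨s, t⟩, ⟨hs, ht⟩, rfl⟩
    exact H.sinSqHalf_nonneg hγ hη ⟨hs.1.le, hs.2⟩ ⟨ht.1.le, ht.2⟩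
  have hmem : sinSqHalf sn γ η (dist p q, dist p r) ∈ S :=
    ⟨_, ⟨⟨ha, le_rfl⟩, ⟨hb, le_rfl⟩⟩, rfl⟩
  refine ⟨sInf S, csInf_le hS hmem, tendsto_order.2 ⟨fun c hc => ?_, fun c hc => ?_⟩⟩
  · filter_upwards [mem_prod_nhdsGT ha hb] with ts hts
    exact hc.trans_le (csInf_le hS ⟨ts, ⟨hts.1, hts.2⟩, rfl⟩)
  · obtain ⟨_, ⟨⟨s, t⟩, ⟨hs, ht⟩, rfl⟩, hlt⟩ := exists_lt_of_csInf_lt ⟨_, hmem⟩ hc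
    filter_upwards [mem_prod_nhdsGT hs.1 ht.1] with ts hts
    exact (H.sinSqHalf_mono hγ hη hts.1.1 hts.2.1 hts.1.2 hts.2.2 hs.2 ht.2).trans_lt hlt

/-- Infinitesimally the model plane is Euclidean: `sn u / u → k`, so each `sn` may be replaced by
its argument in the limit, and the resulting quotient is `(1 - cos) / 2` of the Euclidean comparison
angle. -/
lemma tendsto_cosComparison_aux (H : HasComparison M sn k K) (hγ : IsGeodesic γ p q)
    (hη : IsGeodesic η p r) (hq : p ≠ q) (hr : p ≠ r) {l : ℝ}
    (hl : Tendsto (sinSqHalf sn γ η) (𝓝[>] 0 ×ˢ 𝓝[>] 0) (𝓝 l)) :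
    Tendsto (cosComparison γ η) (𝓝[>] 0 ×ˢ 𝓝[>] 0) (𝓝 (1 - 2 * l)) := by
  have ha := dist_pos.2 hq
  have hb := dist_pos.2 hr
  have hk := H.k_pos
  have t1 : Tendsto (fun ts : ℝ × ℝ => ts.1) (𝓝[>] 0 ×ˢ 𝓝[>] 0) (𝓝 0) :=
    tendsto_fst.mono_right nhdsWithin_le_nhds
  have t2 : Tendsto (fun ts : ℝ × ℝ => ts.2) (𝓝[>] 0 ×ˢ 𝓝[>] 0) (𝓝 0) :=
    tendsto_snd.mono_right nhdsWithin_le_nhds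
  have hev := mem_prod_nhdsGT ha hb
  have tx : Tendsto (fun ts : ℝ × ℝ => (dist (γ ts.1) (η ts.2) + ts.1 - ts.2) / 2)
      (𝓝[>] 0 ×ˢ 𝓝[>] 0) (𝓝 0) := by
    refine tendsto_of_tendsto_of_tendsto_of_le_of_le' tendsto_const_nhds t1 ?_ ?_ <;>
    · filter_upwards [hev] with ts hts
      obtain ⟨h1, h2, h3, h4⟩ := dist_bounds hγ hη ⟨hts.1.1.le, hts.1.2⟩ ⟨hts.2.1.le, hts.2.2⟩
      assumption
  have ty : Tendsto (fun ts : ℝ × ℝ => (dist (γ ts.1) (η ts.2) - ts.1 + ts.2) / 2)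
      (𝓝[>] 0 ×ˢ 𝓝[>] 0) (𝓝 0) := by
    refine tendsto_of_tendsto_of_tendsto_of_le_of_le' tendsto_const_nhds t2 ?_ ?_ <;>
    · filter_upwards [hev] with ts hts
      obtain ⟨h1, h2, h3, h4⟩ := dist_bounds hγ hη ⟨hts.1.1.le, hts.1.2⟩ ⟨hts.2.1.le, hts.2.2⟩
      assumption
  have hφ := H.tendsto_dslope
  have f1 := hφ.comp t1
  have f2 := hφ.comp t2
  have f3 := hφ.comp tx
  have f4 := hφ.comp ty
  have lim := (((hl.mul (f1.mul f2)).div (f3.mul f4) (mul_pos hk hk).ne').const_mul 2).const_sub 1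
  rw [mul_div_cancel_right₀ _ (mul_pos hk hk).ne'] at lim
  refine lim.congr' ?_
  filter_upwards [hev, f3.eventually_ne hk.ne', f4.eventually_ne hk.ne'] with ts hts n3 n4
  have p1 := (H.pos hts.1.1 hts.1.2).ne'
  have p2 := (H.pos hts.2.1 hts.2.2).ne'
  have s0 := hts.1.1.ne'
  have t0 := hts.2.1.ne'
  simp only [Function.comp_apply] at n3 n4 ⊢
  simp only [Pi.div_apply, sinSqHalf, cosComparison]
  rw [H.dslope_mul ts.1] at p1 ⊢
  rw [H.dslope_mul ts.2] at p2 ⊢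
  rw [H.dslope_mul ((dist (γ ts.1) (η ts.2) + ts.1 - ts.2) / 2),
    H.dslope_mul ((dist (γ ts.1) (η ts.2) - ts.1 + ts.2) / 2)]
  have q1 := left_ne_zero_of_mul p1
  have q2 := left_ne_zero_of_mul p2
  generalize dslope sn 0 ((dist (γ ts.1) (η ts.2) + ts.1 - ts.2) / 2) = A at *
  generalize dslope sn 0 ((dist (γ ts.1) (η ts.2) - ts.1 + ts.2) / 2) = B at *
  field_simp
  ring

lemma cos_comparisonAngle (p x y : M) (hx : p ≠ x) (hy : p ≠ y) :
    Real.cos (comparisonAngle p x y) =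
      (dist p x ^ 2 + dist p y ^ 2 - dist x y ^ 2) / (2 * dist p x * dist p y) := by
  have h1 := dist_pos.2 hx
  have h2 := dist_pos.2 hy
  have h3 := dist_triangle p x y
  have h4 := dist_triangle_right p x y
  have h5 := dist_triangle_left x y p
  rw [comparisonAngle, Real.cos_arccos]
  · rw [le_div_iff₀ (by positivity)]
    nlinarith [dist_nonneg (x := x) (y := y)]
  · rw [div_le_iff₀ (by positivity)]
    have := abs_sub_le_iff.2 ⟨sub_le_iff_le_add'.2 (by linarith : dist p x ≤ dist p y + dist x y),
      sub_le_iff_le_add'.2 (by linarith : dist p y ≤ dist p x + dist x y)⟩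
    have := sq_le_sq' (by linarith [abs_le.1 this]) (abs_le.1 this).2
    nlinarith

lemma cos_angleAt_eq (hgeo : IsUniquelyGeodesic M)
    (hq : p ≠ q) (hr : p ≠ r) {l : ℝ}
    (hl : Tendsto (cosComparison (geod p q) (geod p r)) (𝓝[>] 0 ×ˢ 𝓝[>] 0) (𝓝 l)) :
    Real.cos (angleAt p q r) = l := by
  have hγ := hgeo.isGeodesic_geod p q
  have hη := hgeo.isGeodesic_geod p r
  have hev := mem_prod_nhdsGT (dist_pos.2 hq) (dist_pos.2 hr)
  have key : ∀ᶠ ts : ℝ × ℝ in 𝓝[>] 0 ×ˢ 𝓝[>] 0,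
      comparisonAngle p (geod p q ts.1) (geod p r ts.2) =
        Real.arccos (cosComparison (geod p q) (geod p r) ts) ∧
      cosComparison (geod p q) (geod p r) ts ∈ Set.Icc (-1) 1 := by
    filter_upwards [hev] with ts hts
    have d1 := hγ.dist_left ⟨hts.1.1.le, hts.1.2⟩
    have d2 := hη.dist_left ⟨hts.2.1.le, hts.2.2⟩
    have e : cosComparison (geod p q) (geod p r) ts =
        (dist p (geod p q ts.1) ^ 2 + dist p (geod p r ts.2) ^ 2
          - dist (geod p q ts.1) (geod p r ts.2) ^ 2) /
        (2 * dist p (geod p q ts.1) * dist p (geod p r ts.2)) := by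
      rw [d1, d2]; rfl
    rw [e]
    refine ⟨rfl, ?_⟩
    rw [← cos_comparisonAngle _ _ _ (dist_pos.1 (by rw [d1]; exact hts.1.1))
      (dist_pos.1 (by rw [d2]; exact hts.2.1))]
    exact ⟨Real.neg_one_le_cos _, Real.cos_le_one _⟩
  have hmem : l ∈ Set.Icc (-1 : ℝ) 1 := isClosed_Icc.mem_of_tendsto hl (key.mono fun _ h => h.2)
  have hlim : Tendsto (fun ts : ℝ × ℝ => comparisonAngle p (geod p q ts.1) (geod p r ts.2))
      (𝓝[>] 0 ×ˢ 𝓝[>] 0) (𝓝 (Real.arccos l)) :=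
    ((Real.continuous_arccos.tendsto l).comp hl).congr' (key.mono fun _ h => h.1.symm)
  rw [angleAt, alexandrovAngle, hlim.limsup_eq, Real.cos_arccos hmem.1 hmem.2]

/-- The comparison angles along two geodesics converge to the Alexandrov angle. -/
lemma tendsto_cosComparison (H : HasComparison M sn k K) (hgeo : IsUniquelyGeodesic M)
    (hγ : IsGeodesic γ p q) (hη : IsGeodesic η p r) (hq : p ≠ q) (hr : p ≠ r) :
    Tendsto (cosComparison γ η) (𝓝[>] 0 ×ˢ 𝓝[>] 0) (𝓝 (Real.cos (angleAt p q r))) := by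
  have gγ := hgeo.isGeodesic_geod p q
  have gη := hgeo.isGeodesic_geod p r
  obtain ⟨l, -, hl⟩ := H.exists_tendsto_sinSqHalf gγ gη hq hr
  have h := H.tendsto_cosComparison_aux gγ gη hq hr hl
  rw [cos_angleAt_eq hgeo hq hr h]
  refine h.congr' ?_
  filter_upwards [mem_prod_nhdsGT (dist_pos.2 hq) (dist_pos.2 hr)] with ts hts
  rw [cosComparison, cosComparison, (hgeo p q).2 _ _ gγ hγ ⟨hts.1.1.le, hts.1.2⟩,
    (hgeo p r).2 _ _ gη hη ⟨hts.2.1.le, hts.2.2⟩]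

/-- The Alexandrov angle does not exceed the angle of the comparison triangle. -/
lemma one_sub_cos_angleAt_le (H : HasComparison M sn k K) (hgeo : IsUniquelyGeodesic M)
    (hq : p ≠ q) (hr : p ≠ r) :
    (1 - Real.cos (angleAt p q r)) * (sn (dist p q) * sn (dist p r)) ≤
      2 * (sn ((dist q r + dist p q - dist p r) / 2) *
        sn ((dist q r - dist p q + dist p r) / 2)) := by
  have gγ := hgeo.isGeodesic_geod p q
  have gη := hgeo.isGeodesic_geod p r
  obtain ⟨l, hle, hl⟩ := H.exists_tendsto_sinSqHalf gγ gη hq hr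
  have h := H.tendsto_cosComparison_aux gγ gη hq hr hl
  rw [cos_angleAt_eq hgeo hq hr h]
  rw [sinSqHalf, gγ.2.1, gη.2.1, le_div_iff₀
    (mul_pos (H.pos (dist_pos.2 hq) le_rfl) (H.pos (dist_pos.2 hr) le_rfl))] at hle
  linarith

lemma cos_angleAt_comm (H : HasComparison M sn k K) (hgeo : IsUniquelyGeodesic M)
    (hq : p ≠ q) (hr : p ≠ r) :
    Real.cos (angleAt p q r) = Real.cos (angleAt p r q) := by
  refine cos_angleAt_eq hgeo hq hr ?_
  refine ((H.tendsto_cosComparison hgeo (hgeo.isGeodesic_geod p r) (hgeo.isGeodesic_geod p q)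
    hr hq).comp (tendsto_snd.prodMk tendsto_fst)).congr fun ts => ?_
  simp only [Function.comp_apply, cosComparison]
  rw [dist_comm, add_comm (ts.2 ^ 2), mul_right_comm]

/-- The angle depends only on the initial parts of the geodesics. -/
lemma cos_angleAt_of_isGeodesic (H : HasComparison M sn k K) (hgeo : IsUniquelyGeodesic M)
    (hγ : IsGeodesic γ p q) {s : ℝ} (hs0 : 0 < s) (hs : s ≤ dist p q) (hr : p ≠ r) :
    Real.cos (angleAt p (γ s) r) = Real.cos (angleAt p q r) := by
  have ms : s ∈ Set.Icc 0 (dist p q) := ⟨hs0.le, hs⟩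
  have gη := hgeo.isGeodesic_geod p r
  exact tendsto_nhds_unique (H.tendsto_cosComparison hgeo (hγ.restrict ms) gη
      (dist_pos.1 (by rwa [hγ.dist_left ms])) hr)
    (H.tendsto_cosComparison hgeo hγ gη (dist_pos.1 (hs0.trans_le hs)) hr)

/-! ### The tangent cone -/

/-- The limit is the tangent cone distance of the vectors of lengths `A` and `B` in the two
directions. -/
lemma tendsto_dist_div (H : HasComparison M sn k K) (hgeo : IsUniquelyGeodesic M)
    (hγ : IsGeodesic γ p q) (hη : IsGeodesic η p r) (hq : p ≠ q) (hr : p ≠ r) {A B : ℝ}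
    (hA : 0 < A) (hB : 0 < B) :
    Tendsto (fun e : ℝ => dist (γ (A * e)) (η (B * e)) / e) (𝓝[>] 0)
      (𝓝 √(A ^ 2 + B ^ 2 - 2 * A * B * Real.cos (angleAt p q r))) := by
  have hray : ∀ {C : ℝ}, 0 < C → Tendsto (fun e : ℝ => C * e) (𝓝[>] 0) (𝓝[>] 0) := by
    intro C hC
    refine tendsto_nhdsWithin_of_tendsto_nhds_of_eventually_within _ ?_ ?_
    · have : Tendsto (fun e : ℝ => C * e) (𝓝 0) (𝓝 (C * 0)) := tendsto_id.const_mul C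
      rw [mul_zero] at this
      exact this.mono_left nhdsWithin_le_nhds
    · filter_upwards [self_mem_nhdsWithin] with e he
      exact mul_pos hC he
  have h := (H.tendsto_cosComparison hgeo hγ hη hq hr).comp ((hray hA).prodMk (hray hB))
  have h2 := (Real.continuous_sqrt.tendsto _).comp
    ((h.const_mul (2 * A * B)).const_sub (A ^ 2 + B ^ 2))
  refine h2.congr' ?_
  filter_upwards [self_mem_nhdsWithin] with e he
  have he : 0 < e := he
  simp only [Function.comp_apply, cosComparison]
  rw [← Real.sqrt_sq (show 0 ≤ dist (γ (A * e)) (η (B * e)) / e by positivity)]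
  congr 1
  field_simp
  ring

lemma cone_triangle (H : HasComparison M sn k K) (hgeo : IsUniquelyGeodesic M) {x : M}
    (hx : p ≠ x) (hq : p ≠ q) (hr : p ≠ r) {A B C : ℝ} (hA : 0 < A) (hB : 0 < B) (hC : 0 < C) :
    √(A ^ 2 + B ^ 2 - 2 * A * B * Real.cos (angleAt p x q)) ≤
      √(A ^ 2 + C ^ 2 - 2 * A * C * Real.cos (angleAt p x r)) +
      √(B ^ 2 + C ^ 2 - 2 * B * C * Real.cos (angleAt p q r)) := by
  have gx := hgeo.isGeodesic_geod p x
  have gq := hgeo.isGeodesic_geod p q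
  have gr := hgeo.isGeodesic_geod p r
  refine le_of_tendsto_of_tendsto (H.tendsto_dist_div hgeo gx gq hx hq hA hB)
    ((H.tendsto_dist_div hgeo gx gr hx hr hA hC).add
      (H.tendsto_dist_div hgeo gq gr hq hr hB hC)) ?_
  filter_upwards [self_mem_nhdsWithin] with e he
  have he : 0 < e := he
  rw [← add_div]
  gcongr
  exact dist_triangle_right _ _ _

/-- The logarithm map at `p` is `K`-Lipschitz: the Alexandrov angle is at most the model angle, and
`H.ratio` replaces each `sn` by its argument at the cost of one factor `K`. -/
lemma cone_dist_le (H : HasComparison M sn k K) (hgeo : IsUniquelyGeodesic M)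
    (hq : p ≠ q) (hr : p ≠ r) :
    √(dist p q ^ 2 + dist p r ^ 2 - 2 * dist p q * dist p r * Real.cos (angleAt p q r)) ≤
      K * dist q r := by
  have hK := H.one_le
  refine Real.sqrt_le_iff.2 ⟨by positivity, ?_⟩
  have h := H.one_sub_cos_angleAt_le hgeo hq hr
  have ha := dist_pos.2 hq
  have hb := dist_pos.2 hr
  have sa := H.pos ha le_rfl
  have sb := H.pos hb le_rfl
  have t1 := dist_triangle p q r
  have t2 := dist_triangle_right p q r
  have t3 := dist_triangle_left q r p
  have rx := H.ratio p q ((dist q r + dist p q - dist p r) / 2) (by linarith) (by linarith)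
  have ry := H.ratio p r ((dist q r - dist p q + dist p r) / 2) (by linarith) (by linarith)
  have ny := H.nonneg (p := p) (q := r) (u := (dist q r - dist p q + dist p r) / 2)
    (by linarith) (by linarith)
  set a := dist p q
  set b := dist p r
  set c := dist q r
  set X := (c + a - b) / 2 with hX
  set Y := (c - a + b) / 2 with hY
  set C := Real.cos (angleAt p q r)
  have hX0 : 0 ≤ X := by rw [hX]; linarith
  have hY0 : 0 ≤ Y := by rw [hY]; linarith
  have hprod : sn X * a * (sn Y * b) ≤ K * X * sn a * (K * Y * sn b) :=
    mul_le_mul rx ry (by positivity) (by positivity)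
  have h1 : (1 - C) * (a * b) * (sn a * sn b) ≤ 2 * K ^ 2 * X * Y * (sn a * sn b) := by
    calc (1 - C) * (a * b) * (sn a * sn b) = (1 - C) * (sn a * sn b) * (a * b) := by ring
      _ ≤ 2 * (sn X * sn Y) * (a * b) := by gcongr
      _ = 2 * (sn X * a * (sn Y * b)) := by ring
      _ ≤ 2 * (K * X * sn a * (K * Y * sn b)) := by gcongr
      _ = _ := by ring
  have h2 := le_of_mul_le_mul_right h1 (mul_pos sa sb)
  have h3 : 4 * (X * Y) = c ^ 2 - (a - b) ^ 2 := by rw [hX, hY]; ring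
  have hK2 : (a - b) ^ 2 ≤ K ^ 2 * (a - b) ^ 2 :=
    le_mul_of_one_le_left (sq_nonneg _) (one_le_pow₀ hK)
  calc a ^ 2 + b ^ 2 - 2 * a * b * C = (a - b) ^ 2 + 2 * ((1 - C) * (a * b)) := by ring
    _ ≤ K ^ 2 * (a - b) ^ 2 + 2 * (2 * K ^ 2 * X * Y) := by gcongr
    _ = K ^ 2 * (a - b) ^ 2 + K ^ 2 * (4 * (X * Y)) := by ring
    _ = (K * c) ^ 2 := by rw [h3]; ring

/-- The Alexandrov inner product with a fixed unit vector is Lipschitz continuous. -/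
lemma abs_dist_mul_cos_sub_le (H : HasComparison M sn k K) (hgeo : IsUniquelyGeodesic M) {x : M}
    (hx : p ≠ x) (q r : M) :
    |dist p q * Real.cos (angleAt p x q) - dist p r * Real.cos (angleAt p x r)| ≤
      3 * K * dist q r := by
  have hK := H.one_le
  have hbd : ∀ y z : M, |dist y z * Real.cos (angleAt y x z)| ≤ 3 * K * dist y z := by
    intro y z
    rw [abs_mul, abs_of_nonneg dist_nonneg]
    calc dist y z * |Real.cos (angleAt y x z)| ≤ dist y z * 1 := by
          gcongr; exact Real.abs_cos_le_one _
      _ ≤ 3 * K * dist y z := by nlinarith [dist_nonneg (x := y) (y := z)]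
  by_cases hq : p = q
  · subst hq
    simpa using hbd p r
  by_cases hr : p = r
  · subst hr
    simpa [dist_comm] using hbd p q
  have ha := dist_pos.2 hq
  have hb := dist_pos.2 hr
  -- Polarization against the cone vector of length `A = a + b` in direction `x`: with `u`, `v` its
  -- distances to the vectors of `q` and `r`, `2 A (a Cq - b Cr) = a² - b² - (u² - v²)`. This length
  -- makes `u`, `v` at most `2 A`, so that `A` cancels at the end.
  have A0 : 0 < dist p q + dist p r := by linarith
  have t1 := H.cone_triangle hgeo hx hq hr A0 ha hb
  have t2 := H.cone_triangle hgeo hx hr hq A0 hb ha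
  have e1 := H.cone_dist_le hgeo hq hr
  have e2 := H.cone_dist_le hgeo hr hq
  rw [dist_comm r q] at e2
  have hab : |dist p q - dist p r| ≤ dist q r := by
    rw [dist_comm p q, dist_comm p r]; exact abs_dist_sub_le q r p
  have b1 := Real.neg_one_le_cos (angleAt p x q)
  have b2 := Real.neg_one_le_cos (angleAt p x r)
  have b1' := Real.cos_le_one (angleAt p x q)
  have b2' := Real.cos_le_one (angleAt p x r)
  set a := dist p q
  set b := dist p r
  set c := dist q r
  set Cq := Real.cos (angleAt p x q)
  set Cr := Real.cos (angleAt p x r)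
  set u := √((a + b) ^ 2 + a ^ 2 - 2 * (a + b) * a * Cq) with hu
  set v := √((a + b) ^ 2 + b ^ 2 - 2 * (a + b) * b * Cr) with hv
  have nu : 0 ≤ (a + b) ^ 2 + a ^ 2 - 2 * (a + b) * a * Cq := by
    nlinarith [sq_nonneg (a + b - a), mul_nonneg (mul_pos A0 ha).le (sub_nonneg.2 b1')]
  have nv : 0 ≤ (a + b) ^ 2 + b ^ 2 - 2 * (a + b) * b * Cr := by
    nlinarith [sq_nonneg (a + b - b), mul_nonneg (mul_pos A0 hb).le (sub_nonneg.2 b2')]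
  have su : u ^ 2 = (a + b) ^ 2 + a ^ 2 - 2 * (a + b) * a * Cq := Real.sq_sqrt nu
  have sv : v ^ 2 = (a + b) ^ 2 + b ^ 2 - 2 * (a + b) * b * Cr := Real.sq_sqrt nv
  have u0 : 0 ≤ u := Real.sqrt_nonneg _
  have v0 : 0 ≤ v := Real.sqrt_nonneg _
  have u1 : u ≤ 2 * (a + b) := by
    refine Real.sqrt_le_iff.2 ⟨by positivity, ?_⟩
    nlinarith [mul_nonneg (mul_pos A0 ha).le (by linarith : 0 ≤ 1 + Cq)]
  have v1 : v ≤ 2 * (a + b) := by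
    refine Real.sqrt_le_iff.2 ⟨by positivity, ?_⟩
    nlinarith [mul_nonneg (mul_pos A0 hb).le (by linarith : 0 ≤ 1 + Cr)]
  have huv : |u - v| ≤ K * c := abs_sub_le_iff.2 ⟨by linarith, by linarith⟩
  have hc : 0 ≤ c := dist_nonneg
  have id1 : 2 * (a + b) * (a * Cq - b * Cr) = (a - b) * (a + b) - (u - v) * (u + v) := by
    linear_combination su - sv
  have bound : |2 * (a + b) * (a * Cq - b * Cr)| ≤ 2 * (a + b) * (3 * K * c) := by
    rw [id1]
    calc |(a - b) * (a + b) - (u - v) * (u + v)| ≤ |(a - b) * (a + b)| + |(u - v) * (u + v)| :=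
          abs_sub _ _
      _ = |a - b| * (a + b) + |u - v| * (u + v) := by
          rw [abs_mul, abs_mul, abs_of_pos A0, abs_of_nonneg (add_nonneg u0 v0)]
      _ ≤ c * (a + b) + K * c * (2 * (a + b) + 2 * (a + b)) := by gcongr
      _ ≤ 2 * (a + b) * (3 * K * c) := by nlinarith [mul_nonneg hc A0.le]
  rw [abs_mul, abs_of_pos (by positivity)] at bound
  exact le_of_mul_le_mul_left bound (by positivity)

end HasComparison

end Angles

/-! ### Stability of the Alexandrov inner product -/

section Stability

variable {M : Type*} [MetricSpace M]

namespace HasComparison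

variable {sn : ℝ → ℝ} {k K : ℝ}

lemma mono_le (H : HasComparison M sn k K) {p q : M} {u v : ℝ} (hu : 0 ≤ u) (huv : u ≤ v)
    (hv : v ≤ dist p q) : sn u ≤ sn v := by
  rcases huv.eq_or_lt with rfl | h
  · exact le_rfl
  · exact (H.mono p q u v hu h hv).le

/-- Points at the same distance from a common endpoint of two geodesics are not much further apart
than the other endpoints. -/
lemma dist_le_two_mul (H : HasComparison M sn k K) {γ η : ℝ → M} {x p q : M}
    (hγ : IsGeodesic γ x p) (hη : IsGeodesic η x q) {s : ℝ} (hs0 : 0 < s) (hsp : s ≤ dist x p)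
    (hsq : s ≤ dist x q) : dist (γ s) (η s) ≤ 2 * dist p q := by
  have ha := hs0.trans_le hsp
  have hb := hs0.trans_le hsq
  have h := H.comparison x p q γ η hγ hη (dist_pos.1 ha) (dist_pos.1 hb) s ⟨hs0.le, hsp⟩ s
    ⟨hs0.le, hsq⟩
  rw [add_sub_cancel_right, sub_add_cancel] at h
  have t1 := dist_triangle x p q
  have t2 := dist_triangle_right x p q
  have t3 := dist_triangle_left p q x
  -- Otherwise half the distance of `γ s` and `η s` exceeds `dist p q`, hence so does its `sn`. But
  -- both `sn` factors on the right of `h` are at most `sn (dist p q)`, and `sn s` is at most `sn`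
  -- of either side.
  by_contra! hlt
  have hd := H.mono (γ s) (η s) (dist p q) (dist (γ s) (η s) / 2) dist_nonneg (by linarith)
    (by linarith [dist_nonneg (x := γ s) (y := η s)])
  have hδ : 0 ≤ sn (dist p q) := H.nonneg dist_nonneg le_rfl
  have hX := H.mono_le (p := p) (q := q) (u := (dist p q + dist x p - dist x q) / 2)
    (by linarith) (by linarith) le_rfl
  have hY := H.mono_le (p := p) (q := q) (u := (dist p q - dist x p + dist x q) / 2)
    (by linarith) (by linarith) le_rfl
  have hY0 := H.nonneg (p := p) (q := q) (u := (dist p q - dist x p + dist x q) / 2)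
    (by linarith) (by linarith)
  have hs := H.pos hs0 hsp
  have h1 := H.mono_le hs0.le hsp le_rfl
  have h2 := H.mono_le hs0.le hsq le_rfl
  have hss : sn s * sn s ≤ sn (dist x p) * sn (dist x q) :=
    mul_le_mul h1 h2 hs.le (hs.le.trans h1)
  refine lt_irrefl (sn (dist p q) * sn (dist p q) * (sn s * sn s)) ?_
  calc sn (dist p q) * sn (dist p q) * (sn s * sn s)
    _ < sn (dist (γ s) (η s) / 2) * sn (dist (γ s) (η s) / 2) * (sn s * sn s) := by gcongr
    _ ≤ sn (dist (γ s) (η s) / 2) * sn (dist (γ s) (η s) / 2)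
        * (sn (dist x p) * sn (dist x q)) := by gcongr; exact mul_self_nonneg _
    _ ≤ _ := h
    _ ≤ sn (dist p q) * sn (dist p q) * (sn s * sn s) := by gcongr

/-- The angle at `m` towards a point `x` at distance more than `r` is almost the angle towards
the point at distance `r` from `m` on the geodesic from a point `μ` close to `m` to `x`. -/
lemma exists_on_sphere (H : HasComparison M sn k K) (hgeo : IsUniquelyGeodesic M)
    {β m μ x : M} {r : ℝ} (hr : 0 < r) (hμ : dist μ m ≤ r / 4) (hx : r < dist x m) :
    ∃ y : M, dist y m = r ∧ y ≠ μ ∧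
      (μ ≠ β → Real.cos (angleAt μ y β) = Real.cos (angleAt μ x β)) ∧
      (m ≠ β → r * |Real.cos (angleAt m y β) - Real.cos (angleAt m x β)| ≤
        (6 * K + 2) * dist μ m) := by
  have hK := H.one_le
  have g := hgeo.isGeodesic_geod μ x
  have gm := hgeo.isGeodesic_geod m x
  have hcont : ContinuousOn (fun s => dist (geod μ x s) m) (Set.Icc 0 (dist μ x)) := by
    have : ContinuousOn (geod μ x) (Set.Icc 0 (dist μ x)) := by
      refine LipschitzOnWith.continuousOn (K := 1) (LipschitzOnWith.of_dist_le_mul ?_)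
      intro s hs t ht
      rw [g.2.2 s hs t ht, NNReal.coe_one, one_mul, Real.dist_eq]
    exact (continuous_id.dist continuous_const).comp_continuousOn this
  obtain ⟨s, hs, hsr⟩ := intermediate_value_Icc dist_nonneg hcont
    (show r ∈ Set.Icc _ _ by
      simp only [g.1, g.2.1]
      exact ⟨by linarith, hx.le⟩)
  simp only at hsr
  have hds := g.dist_left hs
  have tr1 := dist_triangle (geod μ x s) μ m
  rw [dist_comm (geod μ x s) μ, hds, hsr] at tr1
  have hs0 : 0 < s := by linarith
  have hne : geod μ x s ≠ μ := by
    intro h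
    rw [h, dist_self] at hds
    linarith
  refine ⟨geod μ x s, hsr, hne, fun hβ => H.cos_angleAt_of_isGeodesic hgeo g hs0 hs.2 hβ,
    fun hβ => ?_⟩
  have tr2 := dist_triangle μ m x
  have tr3 := dist_triangle m μ x
  rw [dist_comm x m] at hx
  rw [dist_comm m μ] at tr3
  have hu : dist μ x - s ≤ dist m x := by linarith
  -- The second point lies on the geodesic from `m` to `x`, as far from `x` as the first. It sees
  -- `β` from `m` under the same angle as `x`.
  have hle : dist (geod μ x s) (geod m x (dist m x - (dist μ x - s))) ≤ 2 * dist μ m := by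
    rcases hs.2.eq_or_lt with h | h
    · rw [h, sub_self, sub_zero, g.2.1, gm.2.1, dist_self]
      positivity
    · have := H.dist_le_two_mul g.reverse gm.reverse (s := dist μ x - s) (by linarith)
        (by rw [dist_comm x μ]; linarith) (by rw [dist_comm x m]; linarith)
      simpa using this
  set y := geod μ x s
  set z := geod m x (dist m x - (dist μ x - s))
  have hz : dist z m ≥ r - 2 * dist μ m := by linarith [dist_triangle y z m]
  have hz' : |dist m y - dist m z| ≤ 2 * dist μ m := by
    rw [dist_comm m y, dist_comm m z]
    exact (abs_dist_sub_le y z m).trans hle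
  have hzm : m ≠ z := dist_pos.1 (by rw [dist_comm]; linarith)
  have hym : m ≠ y := dist_pos.1 (by rw [dist_comm]; linarith)
  have hmz := gm.dist_left (s := dist m x - (dist μ x - s)) ⟨by linarith, by linarith [hs.2]⟩
  have hpos : 0 < dist m x - (dist μ x - s) := by rw [← hmz]; exact dist_pos.2 hzm
  have ez := H.cos_angleAt_of_isGeodesic hgeo gm hpos (by linarith [hs.2]) hβ
  -- The Lipschitz bound with `β` as the fixed direction gives `3 * K * 2`; the differing radii of
  -- `y` and `z` contribute the remaining `2`.
  have L := H.abs_dist_mul_cos_sub_le hgeo hβ y z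
  rw [H.cos_angleAt_comm hgeo hβ hym, H.cos_angleAt_comm hgeo hβ hzm, ez, dist_comm m y, hsr] at L
  rw [dist_comm m y, hsr] at hz'
  have hL : 3 * K * dist y z ≤ 6 * K * dist μ m := by
    calc 3 * K * dist y z ≤ 3 * K * (2 * dist μ m) := by gcongr
      _ = _ := by ring
  have hv := Real.abs_cos_le_one (angleAt m x β)
  set u := Real.cos (angleAt m y β)
  set v := Real.cos (angleAt m x β)
  calc r * |u - v| = |r * (u - v)| := by rw [abs_mul, abs_of_pos hr]
    _ = |(r * u - dist m z * v) - (r - dist m z) * v| := by congr 1; ring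
    _ ≤ |r * u - dist m z * v| + |(r - dist m z) * v| := abs_sub _ _
    _ ≤ 6 * K * dist μ m + 2 * dist μ m * 1 := by
        rw [abs_mul]
        gcongr
        exact L.trans hL
    _ = _ := by ring

lemma exists_innerAt_lipschitz_base (H : HasComparison M sn k K) (hgeo : IsUniquelyGeodesic M)
    {β m : M} (hreg : IsRegularNear β m) (R : ℝ) :
    ∃ r C : ℝ, 0 < r ∧ 0 ≤ C ∧ ∀ μ x : M, dist μ m ≤ r → dist x m ≤ R →
      |innerAt β x μ - innerAt β x m| ≤ C * dist μ m := by
  obtain ⟨C₁, C₂, r₁, r₂, h1, h2, hr1, hr2, h⟩ := hreg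
  have hK := H.one_le
  -- `D` controls the change of `d(β, μ) cos ∠_μ(x, β)`: `C₁` for moving the base point with `y` on
  -- the sphere, the second term for replacing `y` by `x` at `m`.
  set D := C₁ + dist β m * ((6 * K + 2) / r₁) with hD
  have hD0 : 0 ≤ D := by positivity
  refine ⟨r₁ / 4, C₂ + (|R| + r₁) * D + dist β m, by positivity, by positivity,
    fun μ x hμ hx => ?_⟩
  obtain ⟨hA, hB⟩ := h μ (by rw [Metric.mem_closedBall]; linarith)
  have hRD : 0 ≤ (|R| + r₁) * D := by positivity
  by_cases hxr : dist x m ≤ r₂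
  · refine (hA x (by rwa [Metric.mem_closedBall])).trans ?_
    gcongr
    linarith [dist_nonneg (x := β) (y := m)]
  obtain ⟨y, hy, hyμ, e1, e2⟩ := H.exists_on_sphere hgeo (β := β) hr1 hμ
    (show r₁ < dist x m by linarith)
  have hB' := hB y hy hyμ
  have eμ : dist β μ * Real.cos (angleAt μ y β) = dist β μ * Real.cos (angleAt μ x β) := by
    by_cases hβ : μ = β
    · simp [hβ]
    · rw [e1 hβ]
  have em : |dist β m * Real.cos (angleAt m y β) - dist β m * Real.cos (angleAt m x β)| ≤
      dist β m * ((6 * K + 2) / r₁) * dist μ m := by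
    by_cases hβ : m = β
    · simp [hβ]
    · rw [← mul_sub, abs_mul, abs_of_nonneg dist_nonneg, mul_assoc]
      gcongr
      rw [div_mul_eq_mul_div, le_div_iff₀ hr1, mul_comm]
      exact e2 hβ
  have hF : |dist β μ * Real.cos (angleAt μ x β) - dist β m * Real.cos (angleAt m x β)| ≤
      D * dist μ m := by
    rw [← eμ]
    calc _ ≤ _ + _ := abs_sub_le _ (dist β m * Real.cos (angleAt m y β)) _
      _ ≤ C₁ * dist μ m + dist β m * ((6 * K + 2) / r₁) * dist μ m := add_le_add hB' em
      _ = D * dist μ m := by rw [hD]; ring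
  have hFm : |dist β m * Real.cos (angleAt m x β)| ≤ dist β m := by
    rw [abs_mul, abs_of_nonneg dist_nonneg]
    exact mul_le_of_le_one_right dist_nonneg (Real.abs_cos_le_one _)
  have hxμ : dist μ x ≤ |R| + r₁ := by
    have := dist_triangle μ m x
    rw [dist_comm m x] at this
    linarith [le_abs_self R]
  have hdd : |dist μ x - dist m x| ≤ dist μ m := abs_dist_sub_le μ m x
  have e : innerAt β x μ - innerAt β x m =
      dist μ x * (dist β μ * Real.cos (angleAt μ x β) - dist β m * Real.cos (angleAt m x β))
      + (dist μ x - dist m x) * (dist β m * Real.cos (angleAt m x β)) := by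
    rw [innerAt, innerAt, dist_comm μ β, dist_comm m β]; ring
  rw [e]
  calc _ ≤ _ + _ := abs_add_le _ _
    _ ≤ (|R| + r₁) * (D * dist μ m) + dist μ m * dist β m := by
      rw [abs_mul, abs_mul, abs_of_nonneg (dist_nonneg (x := μ) (y := x))]
      gcongr
    _ ≤ _ := by nlinarith [mul_nonneg h2.le (dist_nonneg (x := μ) (y := m))]

lemma abs_innerAt_sub_le (H : HasComparison M sn k K) (hgeo : IsUniquelyGeodesic M)
    (β β' x μ : M) : |innerAt β' x μ - innerAt β x μ| ≤ dist μ x * (3 * K * dist β' β) := by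
  by_cases hx : μ = x
  · simp [innerAt, hx]
  have e : innerAt β' x μ - innerAt β x μ = dist μ x *
      (dist μ β' * Real.cos (angleAt μ x β') - dist μ β * Real.cos (angleAt μ x β)) := by
    rw [innerAt, innerAt]; ring
  rw [e, abs_mul, abs_of_nonneg dist_nonneg]
  gcongr
  exact H.abs_dist_mul_cos_sub_le hgeo hx β' β

/-- Local Lipschitz continuity of the Alexandrov inner product in both parameters, uniformly over
bounded sets. -/
lemma exists_innerAt_lipschitz (H : HasComparison M sn k K) (hgeo : IsUniquelyGeodesic M)
    {β m : M} (hreg : IsRegularNear β m) (R : ℝ) :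
    ∃ r C : ℝ, 0 < r ∧ 0 ≤ C ∧ ∀ β' μ x : M, dist μ m ≤ r → dist x m ≤ R →
      |innerAt β' x μ - innerAt β x m| ≤ C * (dist μ m + dist β' β) := by
  obtain ⟨r, C, hr, hC, h⟩ := H.exists_innerAt_lipschitz_base hgeo hreg R
  have hK := H.one_le
  refine ⟨r, C + (|R| + r) * (3 * K), hr, by positivity, fun β' μ x hμ hx => ?_⟩
  have hxμ : dist μ x ≤ |R| + r := by
    have := dist_triangle μ m x
    rw [dist_comm m x] at this
    linarith [le_abs_self R]
  have hd := dist_nonneg (x := μ) (y := m)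
  have hd' := dist_nonneg (x := β') (y := β)
  calc _ ≤ _ + _ := abs_sub_le _ (innerAt β x μ) _
    _ ≤ (|R| + r) * (3 * K * dist β' β) + C * dist μ m := by
      refine add_le_add ((H.abs_innerAt_sub_le hgeo β β' x μ).trans ?_) (h μ x hμ hx)
      gcongr
    _ ≤ _ := by
      have h1 : 0 ≤ C * dist β' β := by positivity
      have h2 : 0 ≤ (|R| + r) * (3 * K) * dist μ m := by positivity
      linarith

end HasComparison

end Stability

/-! ### Risk of classifiers -/

section Risk

/-- The probability that membership in `G` and in `E` disagree, in terms of the conditional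
probability of `E`. -/
lemma measureReal_disagree {Ω : Type*} {m mΩ : MeasurableSpace Ω} {P : Measure Ω}
    [IsProbabilityMeasure P] (hm : m ≤ mΩ) {G E : Set Ω}
    (hG : MeasurableSet[m] G) (hE : MeasurableSet E) :
    P.real {ω | ¬(ω ∈ G ↔ ω ∈ E)} =
      ∫ ω, (G.indicator (fun ω => 1 - (P⟦E | m⟧) ω) ω + Gᶜ.indicator (P⟦E | m⟧) ω) ∂P := by
  have hint : Integrable (E.indicator fun _ => (1 : ℝ)) P :=
    (integrable_const 1).indicator hE
  have hc : Integrable (P⟦E | m⟧) P := integrable_condExp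
  have key : ∀ {S : Set Ω}, MeasurableSet[m] S → ∫ ω in S, (P⟦E | m⟧) ω ∂P = P.real (S ∩ E) := by
    intro S hS
    rw [setIntegral_condExp hm hint hS, setIntegral_indicator hE]
    simp
  have hG' := hm _ hG
  have h1c : Integrable (fun ω => 1 - (P⟦E | m⟧) ω) P := (integrable_const 1).sub hc
  have hset : {ω | ¬(ω ∈ G ↔ ω ∈ E)} = (G \ E) ∪ (Gᶜ ∩ E) := by
    ext ω
    simp only [Set.mem_ofPred_eq, Set.mem_union, Set.mem_sdiff, Set.mem_inter_iff, Set.mem_compl_iff]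
    tauto
  have hdisj : Disjoint (G \ E) (Gᶜ ∩ E) := by
    rw [Set.disjoint_left]
    rintro ω ⟨h1, -⟩ ⟨h2, -⟩
    exact h2 h1
  rw [hset, measureReal_union hdisj (hG'.compl.inter hE), integral_add
    (h1c.indicator hG') (hc.indicator hG'.compl),
    integral_indicator hG', integral_indicator hG'.compl, key hG.compl,
    integral_sub (integrable_const 1).integrableOn hc.integrableOn, key hG]
  have := measureReal_inter_add_sdiff (μ := P) (s := G) hE
  simp
  linarith

/-- The left side is `|tanh (h / 2)|`. By oddness it suffices to use `1 - exp (-u) ≤ u` for `u ≥ 0`.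
-/
lemma abs_two_mul_logistic_sub_one_le (h : ℝ) :
    |2 * (1 + Real.exp (-h))⁻¹ - 1| ≤ |h| := by
  have key : ∀ u : ℝ, 0 ≤ u → |(1 - Real.exp (-u)) / (1 + Real.exp (-u))| ≤ u := by
    intro u hu
    have h1 : Real.exp (-u) ≤ 1 := Real.exp_le_one_iff.2 (by linarith)
    have h2 := Real.exp_pos (-u)
    have h3 := Real.add_one_le_exp (-u)
    rw [abs_of_nonneg (div_nonneg (by linarith) (by linarith)), div_le_iff₀ (by linarith)]
    nlinarith
  have e : 2 * (1 + Real.exp (-h))⁻¹ - 1 = (1 - Real.exp (-h)) / (1 + Real.exp (-h)) := by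
    have := Real.exp_pos (-h)
    field_simp
    ring
  rw [e]
  rcases le_total 0 h with hh | hh
  · rw [abs_of_nonneg hh]
    exact key h hh
  · rw [abs_of_nonpos hh]
    refine le_trans (le_of_eq ?_) (key (-h) (by linarith))
    rw [neg_neg, Real.exp_neg, ← abs_neg]
    have := Real.exp_pos h
    congr 1
    field_simp
    ring

lemma half_le_logistic_iff (h : ℝ) : 1 / 2 ≤ (1 + Real.exp (-h))⁻¹ ↔ 0 ≤ h := by
  rw [one_div, inv_le_inv₀ two_pos (by positivity)]
  constructor
  · intro h1
    have := Real.exp_le_one_iff.1 (by linarith : Real.exp (-h) ≤ 1)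
    linarith
  · intro h1
    have := Real.exp_le_one_iff.2 (by linarith : -h ≤ 0)
    linarith

/-- Prediction of `E` by an event `F` instead of the nonnegativity of the log-odds `h` increases
the risk by at most a bound for `|h|` on the set where the two predictions differ. -/
lemma measureReal_disagree_le {Ω : Type*} {m mΩ : MeasurableSpace Ω} {P : Measure Ω}
    [IsProbabilityMeasure P] (hm : m ≤ mΩ) {F E : Set Ω} (hF : MeasurableSet[m] F)
    (hE : MeasurableSet E) {h : Ω → ℝ} (hmodel : P⟦E | m⟧ =ᵐ[P] fun ω => (1 + Real.exp (-h ω))⁻¹)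
    {D : ℝ} (hD0 : 0 ≤ D) (hD : ∀ᵐ ω ∂P, ¬(ω ∈ F ↔ 0 ≤ h ω) → |h ω| ≤ D) :
    P.real {ω | ¬(ω ∈ F ↔ ω ∈ E)} ≤ P.real {ω | ¬(0 ≤ h ω ↔ ω ∈ E)} + D := by
  -- `h` is not assumed measurable. `G` is an `m`-measurable event that almost surely agrees with `0
  -- ≤ h`.
  set G : Set Ω := {ω | 1 / 2 ≤ (P⟦E | m⟧) ω}
  have hG : MeasurableSet[m] G := stronglyMeasurable_condExp.measurable measurableSet_Ici
  have hGae : ∀ᵐ ω ∂P, (ω ∈ G ↔ 0 ≤ h ω) := by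
    filter_upwards [hmodel] with ω hω
    rw [← half_le_logistic_iff, ← hω]
    rfl
  have eG : P.real {ω | ¬(0 ≤ h ω ↔ ω ∈ E)} = P.real {ω | ¬(ω ∈ G ↔ ω ∈ E)} := by
    refine measureReal_congr ?_
    filter_upwards [hGae] with ω hω
    refine propext ?_
    change ¬(0 ≤ h ω ↔ ω ∈ E) ↔ ¬(ω ∈ G ↔ ω ∈ E)
    rw [hω]
  have hc : Integrable (P⟦E | m⟧) P := integrable_condExp
  have hi : ∀ {S : Set Ω}, MeasurableSet[m] S → Integrable (fun ω =>
      S.indicator (fun ω => 1 - (P⟦E | m⟧) ω) ω + Sᶜ.indicator (P⟦E | m⟧) ω) P := fun hS =>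
    (((integrable_const 1).sub hc).indicator (hm _ hS)).add (hc.indicator (hm _ hS).compl)
  rw [eG, measureReal_disagree hm hF hE, measureReal_disagree hm hG hE]
  have hconst : D = ∫ _, D ∂P := by simp
  rw [hconst, ← integral_add (hi hG) (integrable_const D)]
  refine integral_mono_ae (hi hF) ((hi hG).add (integrable_const D)) ?_
  filter_upwards [hGae, hmodel, hD] with ω h1 h2 h3
  -- Where the predictions differ, the conditional risks `π` and `1 - π` differ by `|2 π - 1|`.
  have h4 : |2 * (P⟦E | m⟧) ω - 1| ≤ |h ω| := by
    rw [h2]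
    exact abs_two_mul_logistic_sub_one_le _
  have h5 : ¬(ω ∈ F ↔ ω ∈ G) → |2 * (P⟦E | m⟧) ω - 1| ≤ D := fun hne =>
    h4.trans (h3 (by rwa [← h1]))
  by_cases hωF : ω ∈ F <;> by_cases hωG : ω ∈ G <;>
    simp only [Set.indicator, Set.mem_compl_iff, hωF, hωG, not_true_eq_false, not_false_eq_true,
      if_true, if_false, add_zero, zero_add]
  · linarith
  · have := abs_le.1 (h5 (by tauto))
    linarith
  · have := abs_le.1 (h5 (by tauto))
    linarith
  · linarith

lemma classifier_eq_one_iff {M : Type*} [MetricSpace M] {β μ x : M} :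
    classifier β μ x = 1 ↔ 0 ≤ innerAt β x μ := by
  unfold classifier
  split_ifs with h <;> simp [h]

variable {Ω : Type*} [MeasurableSpace Ω] {P : Measure Ω} [IsProbabilityMeasure P]

/-- The risk of a classifier exceeds the Bayes risk by at most a bound for the log-odds on the
set where the two classifiers differ. -/
lemma risk_le_add {M : Type*} [MetricSpace M] [MeasurableSpace M] {X : Ω → M} {Y : Ω → Fin 2}
    (hX : Measurable X) (hY : Measurable Y)
    {β μ : M} (hmodel : IsLogisticModel P X Y β μ) {f : M → Fin 2} (hf : Measurable f) {D : ℝ}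
    (hD0 : 0 ≤ D)
    (hD : ∀ᵐ ω ∂P, f (X ω) ≠ classifier β μ (X ω) → |innerAt β (X ω) μ| ≤ D) :
    P.real {ω | f (X ω) ≠ Y ω} ≤ P.real {ω | classifier β μ (X ω) ≠ Y ω} + D := by
  have hfin : ∀ a b : Fin 2, a ≠ b ↔ ¬(a = 1 ↔ b = 1) := by decide
  have h := measureReal_disagree_le hX.comap_le (F := {ω | f (X ω) = 1})
    ⟨f ⁻¹' {1}, hf (measurableSet_singleton 1), rfl⟩ (hY (measurableSet_singleton 1)) hmodel hD0 (by
      filter_upwards [hD] with ω hω hne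
      refine hω ?_
      rw [hfin, classifier_eq_one_iff]
      exact hne)
  simp only [hfin, classifier_eq_one_iff]
  exact h

/-- The risk of a logistic classifier with parameters `β'`, `μ'` exceeds the Bayes risk by at most
a multiple of the distance to the true parameters. -/
lemma exists_risk_classifier_le {M : Type*} [MetricSpace M] [MeasurableSpace M] {sn : ℝ → ℝ} {k K : ℝ} (H : HasComparison M sn k K)
    (hgeo : IsUniquelyGeodesic M) {X : Ω → M} {Y : Ω → Fin 2} (hX : Measurable X)
    (hY : Measurable Y) {β μ : M} (hsupp : ∃ B : Set M, Bornology.IsBounded B ∧ ∀ᵐ ω ∂P, X ω ∈ B)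
    (hmodel : IsLogisticModel P X Y β μ) (hreg : IsRegularNear β μ) :
    ∃ C : ℝ, 0 < C ∧ ∀ β' μ' : M, Measurable (classifier β' μ') →
      P.real {ω | classifier β' μ' (X ω) ≠ Y ω} ≤
        P.real {ω | classifier β μ (X ω) ≠ Y ω} + C * (dist μ μ' + dist β β') := by
  obtain ⟨B, hB, hXB⟩ := hsupp
  obtain ⟨R, hR⟩ := hB.subset_closedBall μ
  obtain ⟨r, C, hr, hC, h⟩ := H.exists_innerAt_lipschitz hgeo hreg R
  -- The summand `1 / r` serves `dist μ' μ > r`, where the risk is at most `1 ≤ dist μ' μ / r`.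
  refine ⟨C + 1 / r, by positivity, fun β' μ' hf => ?_⟩
  rw [dist_comm μ μ', dist_comm β β']
  have d1 := dist_nonneg (x := μ') (y := μ)
  have d2 := dist_nonneg (x := β') (y := β)
  by_cases hμ : dist μ' μ ≤ r
  · have := risk_le_add hX hY hmodel hf (D := C * (dist μ' μ + dist β' β)) (by positivity) (by
      filter_upwards [hXB] with ω hω hne
      refine le_trans ?_ (h β' μ' (X ω) hμ (hR hω))
      have hiff : ¬(0 ≤ innerAt β' (X ω) μ' ↔ 0 ≤ innerAt β (X ω) μ) := by
        intro hiff
        apply hne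
        simp only [classifier, hiff]
      rcases le_or_gt 0 (innerAt β (X ω) μ) with h1 | h1
      · have h2 : innerAt β' (X ω) μ' < 0 := by
          by_contra! h2
          exact hiff (by tauto)
        rw [abs_of_nonneg h1, abs_of_nonpos (by linarith)]
        linarith
      · have h2 : 0 ≤ innerAt β' (X ω) μ' := by
          by_contra! h2
          exact hiff (by constructor <;> intro <;> linarith)
        rw [abs_of_neg h1, abs_of_nonneg (by linarith)]
        linarith)
    refine this.trans ?_
    gcongr
    linarith [one_div_pos.2 hr]
  · have h1 : 1 ≤ 1 / r * dist μ' μ := by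
      rw [one_div_mul_eq_div, le_div_iff₀ hr]
      linarith
    have h2 : P.real {ω | classifier β' μ' (X ω) ≠ Y ω} ≤ 1 := measureReal_le_one
    have h3 : 0 ≤ P.real {ω | classifier β μ (X ω) ≠ Y ω} := measureReal_nonneg
    have h4 : 0 ≤ C * (dist μ' μ + dist β' β) := by positivity
    have h5 : 0 ≤ 1 / r * dist β' β := by positivity
    linarith

lemma lintegral_le_sqrt_lintegral_sq {f : Ω → ℝ≥0∞} (hf : AEMeasurable f P) :
    ∫⁻ ω, f ω ∂P ≤ (∫⁻ ω, f ω ^ 2 ∂P) ^ (1 / 2 : ℝ) := by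
  have := ENNReal.lintegral_mul_le_Lp_mul_Lq P Real.HolderConjugate.two_two hf
    (aemeasurable_const (b := (1 : ℝ≥0∞)))
  simpa using this

end Risk

end AlexandrovLogit

end

/-! ### The main theorem: averaging the risk bound over the sample -/

open AlexandrovLogit
theorem mainTheorem6
    {M : Type*} [MetricSpace M] [CompleteSpace M] [MeasurableSpace M] [BorelSpace M]
    (κ : ℝ) (hgeo : IsUniquelyGeodesic M) (hcurv : CurvatureLE M κ)
    (hdiam : Metric.ediam (Set.univ : Set M) ≤ modelDiam κ / 2)
    {Ω : Type*} [MeasurableSpace Ω] (P : Measure Ω) [IsProbabilityMeasure P]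
    -- the pair to be classified and the model
    (X : Ω → M) (Y : Ω → Fin 2) (hX : Measurable X) (hY : Measurable Y)
    (μs βs : M) (hsupp : ∃ B : Set M, Bornology.IsBounded B ∧ ∀ᵐ ω ∂P, X ω ∈ B)
    (hμs : IsFrechetMean P X μs) (hmodel : IsLogisticModel P X Y βs μs)
    (hreg : IsRegularNear βs μs)
    -- the sample: i.i.d. copies of the pair, independent of it
    (Xs : ℕ → Ω → M) (Ys : ℕ → Ω → Fin 2)
    (hident : ∀ i, IdentDistrib (fun ω => (Xs i ω, Ys i ω)) (fun ω => (X ω, Y ω)) P P)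
    (hindep : iIndepFun (fun i ω => (Xs i ω, Ys i ω)) P)
    (hnew : IndepFun (fun ω => (X ω, Y ω)) (fun ω i => (Xs i ω, Ys i ω)) P) :
    ∃ c : ℝ, 0 < c ∧
      ∀ (n : ℕ) (_ : 1 ≤ n)
        -- the estimators, as measurable functions of the sample of size `n`
        (μhat : (Fin n → M) → M) (βhat : (Fin n → M × Fin 2) → M)
        (_ : Measurable μhat) (_ : Measurable βhat)
        (_ : ∀ᵐ ω ∂P, IsSampleFrechetMean (fun i : Fin n => Xs i ω)
          (μhat fun i : Fin n => Xs i ω))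
        (_ : ∀ᵐ ω ∂P, ∀ β : M,
          logLik (fun i : Fin n => (Xs i ω, Ys i ω)) (μhat fun i : Fin n => Xs i ω) β ≤
            logLik (fun i : Fin n => (Xs i ω, Ys i ω)) (μhat fun i : Fin n => Xs i ω)
              (βhat fun i : Fin n => (Xs i ω, Ys i ω)))
        -- the plug-in classifier is a measurable function of the sample and the covariate
        (_ : Measurable fun z : (Fin n → M × Fin 2) × M =>
          classifier (βhat z.1) (μhat fun i => (z.1 i).1) z.2),
        ENNReal.ofReal (excessRisk P X Y (classifier βs μs)
            (fun ω => classifier (βhat fun i : Fin n => (Xs i ω, Ys i ω))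
              (μhat fun i : Fin n => Xs i ω))) ≤
          ENNReal.ofReal c *
            (∫⁻ ω, edist μs (μhat fun i : Fin n => Xs i ω) ^ 2 ∂P +
              ∫⁻ ω, edist βs (βhat fun i : Fin n => (Xs i ω, Ys i ω)) ^ 2 ∂P) ^ (1 / 2 : ℝ) := by
  obtain ⟨sn, k, K, H⟩ := exists_hasComparison hcurv hdiam
  obtain ⟨C, hC, hrisk⟩ := exists_risk_classifier_le H hgeo hX hY hsupp hmodel hreg
  -- The factor `2` arises because the two mean distances are each bounded by the same square root.
  refine ⟨2 * C, by positivity, ?_⟩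
  intro n _ μhat βhat hμhat hβhat _ _ hmeas
  set S : Ω → Fin n → M × Fin 2 := fun ω i => (Xs i ω, Ys i ω) with hSdef
  have hS : AEMeasurable S P := aemeasurable_pi_iff.2 fun i => (hident i).aemeasurable_fst
  have hXY : Measurable fun ω => (X ω, Y ω) := hX.prodMk hY
  have hindS : IndepFun S (fun ω => (X ω, Y ω)) P :=
    (hnew.comp measurable_id
      (measurable_pi_lambda (fun (g : ℕ → M × Fin 2) (i : Fin n) => g i)
        fun i => measurable_pi_apply _)).symm
  have hlaw := (indepFun_iff_map_prod_eq_prod_map_map hS hXY.aemeasurable).1 hindS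
  set a : (Fin n → M × Fin 2) → ℝ≥0∞ := fun z => edist μs (μhat fun i => (z i).1) with ha
  set b : (Fin n → M × Fin 2) → ℝ≥0∞ := fun z => edist βs (βhat z) with hb
  have ma : Measurable a := (continuous_const.edist continuous_id).measurable.comp
    (hμhat.comp (measurable_pi_lambda _ fun i => (measurable_pi_apply i).fst))
  have mb : Measurable b := (continuous_const.edist continuous_id).measurable.comp hβhat
  set T : Set ((Fin n → M × Fin 2) × (M × Fin 2)) :=
    {w | classifier (βhat w.1) (μhat fun i => (w.1 i).1) w.2.1 ≠ w.2.2} with hTdef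
  have hT : MeasurableSet T := by
    have h1 : Measurable fun w : (Fin n → M × Fin 2) × (M × Fin 2) =>
        classifier (βhat w.1) (μhat fun i => (w.1 i).1) w.2.1 :=
      hmeas.comp (measurable_fst.prodMk measurable_snd.fst)
    exact (measurableSet_eq_fun h1 measurable_snd.snd).compl
  set r₀ := P {ω | classifier βs μs (X ω) ≠ Y ω} with hr₀
  -- With the sample frozen at `z`, the plug-in classifier is deterministic and `hrisk` applies. The
  -- product law `hlaw` later allows integration over `z`.
  have hsection : ∀ z, (P.map fun ω => (X ω, Y ω)) (Prod.mk z ⁻¹' T) ≤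
      r₀ + ENNReal.ofReal C * (a z + b z) := by
    intro z
    rw [Measure.map_apply hXY (measurable_prodMk_left hT)]
    have h := hrisk (βhat z) (μhat fun i => (z i).1) (hmeas.comp measurable_prodMk_left)
    have h' := ENNReal.ofReal_le_ofReal h
    rw [ENNReal.ofReal_add measureReal_nonneg (by positivity), ofReal_measureReal,
      ofReal_measureReal, ENNReal.ofReal_mul hC.le, ENNReal.ofReal_add dist_nonneg dist_nonneg,
      ← edist_dist, ← edist_dist] at h'
    exact h'
  have hmain : P {ω | classifier (βhat (S ω)) (μhat fun i => (S ω i).1) (X ω) ≠ Y ω} ≤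
      r₀ + ENNReal.ofReal C * (∫⁻ ω, a (S ω) ∂P + ∫⁻ ω, b (S ω) ∂P) := by
    have : IsProbabilityMeasure (P.map S) := Measure.isProbabilityMeasure_map hS
    calc P {ω | classifier (βhat (S ω)) (μhat fun i => (S ω i).1) (X ω) ≠ Y ω}
        = (P.map fun ω => (S ω, (X ω, Y ω))) T := by
          rw [Measure.map_apply_of_aemeasurable (hS.prodMk hXY.aemeasurable) hT]
          rfl
      _ = ∫⁻ z, (P.map fun ω => (X ω, Y ω)) (Prod.mk z ⁻¹' T) ∂(P.map S) := by
          rw [hlaw, Measure.prod_apply hT]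
      _ ≤ ∫⁻ z, (r₀ + ENNReal.ofReal C * (a z + b z)) ∂(P.map S) := lintegral_mono hsection
      _ = r₀ + ENNReal.ofReal C * (∫⁻ z, a z ∂(P.map S) + ∫⁻ z, b z ∂(P.map S)) := by
          rw [lintegral_add_left measurable_const, lintegral_const_mul (f := fun z => a z + b z) _ (ma.add mb),
            lintegral_add_left ma]
          simp
      _ = _ := by rw [lintegral_map' ma.aemeasurable hS, lintegral_map' mb.aemeasurable hS]
  have ja := lintegral_le_sqrt_lintegral_sq (ma.comp_aemeasurable hS)
  have jb := lintegral_le_sqrt_lintegral_sq (mb.comp_aemeasurable hS)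
  set I := (∫⁻ ω, edist μs (μhat fun i : Fin n => Xs i ω) ^ 2 ∂P +
    ∫⁻ ω, edist βs (βhat fun i : Fin n => (Xs i ω, Ys i ω)) ^ 2 ∂P) ^ (1 / 2 : ℝ) with hI
  have ja' : ∫⁻ ω, a (S ω) ∂P ≤ I :=
    ja.trans (ENNReal.rpow_le_rpow le_self_add (by norm_num))
  have jb' : ∫⁻ ω, b (S ω) ∂P ≤ I :=
    jb.trans (ENNReal.rpow_le_rpow le_add_self (by norm_num))
  rw [excessRisk, ENNReal.ofReal_sub _ measureReal_nonneg, ofReal_measureReal,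
    ofReal_measureReal, tsub_le_iff_left]
  calc _ ≤ r₀ + ENNReal.ofReal C * (∫⁻ ω, a (S ω) ∂P + ∫⁻ ω, b (S ω) ∂P) := hmain
    _ ≤ r₀ + ENNReal.ofReal C * (I + I) := by gcongr
    _ = r₀ + ENNReal.ofReal (2 * C) * I := by
      rw [ENNReal.ofReal_mul two_pos.le, ENNReal.ofReal_ofNat]
      ring
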